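/- Let $\Lambda$ be a countable (discrete) group. A \emph{trace} on $\Lambda$ is a function $\varphi:\Lambda\to\mathbb{C}$ with $\varphi(e)=1$ that is conjugation invariant and positive definite, i.e. for all $n$ and all $g_1,\dots,g_n\in\Lambda$ the matrix $(\varphi(g_i^{-1}g_j))_{i,j}$ is positive semidefinite. A \emph{character} of $\Lambda$ is an extreme point of the convex set of traces on $\Lambda$. The group $\Lambda$ is \emph{character rigid} if every character of $\Lambda$ either is finite-dimensional, i.e. of the form $\frac{1}{\dim\pi}\,\mathrm{tr}\circ\pi$ for some finite-dimensional irreducible unitary representation $\pi$ of $\Lambda$, or vanishes outside the center of $\Lambda$. Let $\Lambda$ be a countable group with center $C=\mathrm{Z}(\Lambda)$ (possibly infinite). Assume that the quotient group $\Lambda/C$ has trivial center and has at most countably many finite-dimensional unitary representations up to unitary equivalence. Then $\Lambda$ is character rigid if and only if $\Lambda/C$ is character rigid. -/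

import Mathlib

noncomputable section

namespace CharRigidity

open scoped ComplexOrder in
/-- `φ : Λ → ℂ` is positive definite: all matrices `(φ (gᵢ⁻¹ gⱼ))ᵢⱼ` are positive semidefinite. -/
def IsPositiveDefinite {Λ : Type*} [Group Λ] (φ : Λ → ℂ) : Prop :=
  ∀ (n : ℕ) (g : Fin n → Λ),
    (Matrix.of fun i j : Fin n => φ ((g i)⁻¹ * g j)).PosSemidef

/-- The set of traces on `Λ`: normalized, conjugation-invariant, positive definite functions. -/
def traces (Λ : Type*) [Group Λ] : Set (Λ → ℂ) :=
  {φ | IsPositiveDefinite φ ∧ φ 1 = 1 ∧ ∀ g h : Λ, φ (h * g * h⁻¹) = φ g}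

/-- The characters of `Λ`: the extreme points of the convex set of traces. -/
def characters (Λ : Type*) [Group Λ] : Set (Λ → ℂ) :=
  (traces Λ).extremePoints ℝ

/-- A unitary representation of `Λ` on `ℂⁿ`, i.e. a homomorphism `Λ → U(n)`. -/
abbrev UnitaryRep (Λ : Type*) [Group Λ] (n : ℕ) : Type _ :=
  Λ →* Matrix.unitaryGroup (Fin n) ℂ

/-- The underlying linear representation on `ℂⁿ` of a unitary representation. -/
def UnitaryRep.toRepresentation {Λ : Type*} [Group Λ] {n : ℕ} (π : UnitaryRep Λ n) :
    Representation ℂ Λ (Fin n → ℂ) where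
  toFun g := Matrix.toLin' (π g : Matrix (Fin n) (Fin n) ℂ)
  map_one' := by simp [Module.End.one_eq_id]
  map_mul' g h := by simp [Matrix.toLin'_mul, Module.End.mul_eq_comp]

/-- Unitary equivalence of representations on `ℂⁿ`: conjugacy by an element of `U(n)`. -/
def unitaryEquivalence (Λ : Type*) [Group Λ] (n : ℕ) : Setoid (UnitaryRep Λ n) where
  r π ρ := ∃ u : Matrix.unitaryGroup (Fin n) ℂ, ∀ g : Λ, ρ g = u * π g * u⁻¹
  iseqv :=
    { refl := fun π => ⟨1, fun g => by simp⟩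
      symm := fun {π ρ} ⟨u, hu⟩ => ⟨u⁻¹, fun g => by rw [hu g]; group⟩
      trans := fun {π ρ σ} ⟨u, hu⟩ ⟨v, hv⟩ =>
        ⟨v * u, fun g => by rw [hv g, hu g]; group⟩ }

/-- `Λ` has at most countably many finite-dimensional unitary representations, up to unitary
equivalence. -/
def CountablyManyFinDimUnitaryReps (Λ : Type*) [Group Λ] : Prop :=
  Countable (Σ n : ℕ, Quotient (unitaryEquivalence Λ n))

/-- `φ` is of the form `(1 / dim π) tr ∘ π` for some finite-dimensional irreducible unitary
representation `π` (irreducibility includes `dim π ≠ 0`). -/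
def IsFiniteDimensional {Λ : Type*} [Group Λ] (φ : Λ → ℂ) : Prop :=
  ∃ (n : ℕ) (π : UnitaryRep Λ n), π.toRepresentation.IsIrreducible ∧
    ∀ g : Λ, φ g = (1 / (n : ℂ)) * (π g : Matrix (Fin n) (Fin n) ℂ).trace

/-- `Λ` is character rigid: every character is finite-dimensional or vanishes outside the
center. -/
def IsCharacterRigid (Λ : Type*) [Group Λ] : Prop :=
  ∀ φ ∈ characters Λ,
    IsFiniteDimensional φ ∨ ∀ g : Λ, g ∉ Subgroup.center Λ → φ g = 0

end CharRigidity

end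

/-!
Write `C` for the center of `Λ` and `q` for the quotient map to `Λ / C`.

**From `Λ` to `Λ / C`.** A convex decomposition of `ψ ∘ q` into traces has summands equal to `1` on
`C`, since traces are bounded by `1`; by the Cauchy–Schwarz inequality such summands are
`C`-invariant and descend to `Λ / C`. So `ψ ∘ q` is a character whenever `ψ` is
(`comp_mem_characters`), and the dichotomy for `ψ ∘ q` gives the one for `ψ`, because a unitary
matrix with maximal trace is the identity.

**From `Λ / C` to `Λ`.** Let `φ` be a character of `Λ`. By extremality, a
conjugation-invariant positive definite function below a multiple of `φ` is proportional to `φ`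
(`eq_smul_of_dominated`), which yields `φ (g c) = φ g φ c` and `|φ c| = 1` for `c ∈ C`. Hence
`|φ|²` is a trace on `Λ / C`. By Choquet's theorem it is an integral of characters of `Λ / C`; as
only countably many of these are finite-dimensional, either some finite-dimensional `χ` occurs as an
atom, or `|φ|²` vanishes outside `C`
(`exists_dominated_or_vanishing`).

It remains to see that `φ` is finite-dimensional if `a χ ≤ |φ|²` with `a > 0`. Let `H` be the GNS
space of `φ`, with cyclic vectors `v g`. The Hilbert space generated by the kernel of `|φ|²` maps
contractively to the operators on `H`, by sending its generators to the rank one operators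
`|v g⟩⟨v g|`, so all its elements become compact operators. The domination places the matrix
coefficients of the representation behind `χ` in this Hilbert space; the resulting compact
operators `A j` give a nonzero compact positive operator `∑ j, (A j)* (A j)` commuting with `Λ`.
One of its eigenspaces is a finite-dimensional invariant subspace of `H`
(`exists_invariant_of_dominated`). For a minimal such subspace `W`, the trace of the action on `W`
is dominated by a multiple of `φ`: this uses right translations on `H`, which are bounded because
`φ` is conjugation invariant (`exists_clm_orbit`). By extremality, `φ` is the normalized trace of
the irreducible representation on `W` (`isFiniteDimensional_of_invariant`).
-/

noncomputable section

namespace CharRigidity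

/-! ### Positive semidefinite kernels and their Hilbert spaces -/

section Kernel

open Matrix
open scoped ComplexOrder InnerProductSpace

universe u

variable {X : Type*}

/-- Positive semidefiniteness of an infinite matrix is tested on finite tuples of indices,
repetitions allowed. -/
theorem posSemidef_of_fin_submatrix {M : Matrix X X ℂ}
    (h : ∀ (n : ℕ) (g : Fin n → X), (M.submatrix g g).PosSemidef) : M.PosSemidef := by
  refine ⟨?_, fun x => ?_⟩
  · ext i j
    have := (h 2 ![i, j]).1.apply 0 1
    simpa using this
  · let e := x.support.equivFin
    have h1 : (M.submatrix (Subtype.val : x.support → X) Subtype.val).PosSemidef := by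
      have := (h _ (fun i => (e.symm i : X))).submatrix e
      simpa [Matrix.submatrix_submatrix, Function.comp_def] using this
    have h2 := h1.dotProduct_mulVec_nonneg fun i => x i
    simp only [dotProduct, mulVec, Pi.star_apply, submatrix_apply, Finset.mul_sum,
      ← mul_assoc] at h2
    have h3 : ∀ F : X → X → ℂ, ∑ i : x.support, ∑ j : x.support, F i j =
        ∑ i ∈ x.support, ∑ j ∈ x.support, F i j := fun F => by
      rw [← Finset.sum_coe_sort x.support]
      exact Finset.sum_congr rfl fun i _ => Finset.sum_coe_sort x.support fun j => F i j
    rwa [h3 fun i j => star (x i) * M i j * x j] at h2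

/-- A positive semidefinite matrix is the Gram matrix of a total family in a Hilbert space (for the
kernel of a positive definite function: the GNS construction). It is the reproducing kernel Hilbert
space of the corresponding scalar kernel. -/
theorem exists_hilbert_of_posSemidef {X : Type u} {M : Matrix X X ℂ} (hM : M.PosSemidef) :
    ∃ (H : Type u) (_ : NormedAddCommGroup H) (_ : InnerProductSpace ℂ H) (_ : CompleteSpace H)
      (v : X → H), (∀ x y, ⟪v x, v y⟫_ℂ = M x y) ∧
        (Submodule.span ℂ (Set.range v)).topologicalClosure = ⊤ := by
  let K : Matrix X X (ℂ →L[ℂ] ℂ) := .of fun x y => M x y • ContinuousLinearMap.id ℂ ℂ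
  have hK : K.PosSemidef := by
    have hiff := (RKHS.posSemidef_tfae (K := K)).out 0 2
    refine hiff.mpr ⟨?_, fun c => ?_⟩
    · ext i j
      simp only [K, Matrix.conjTranspose_apply, Matrix.of_apply, star_smul]
      rw [hM.1.apply]
      have : star (ContinuousLinearMap.id ℂ ℂ) = ContinuousLinearMap.id ℂ ℂ := star_one (ℂ →L[ℂ] ℂ)
      rw [this]
    · have := (Complex.le_def.1 (hM.2 c)).1
      have hc : ∀ i j, (starRingEnd ℂ) (M i j) = M j i := fun i j => hM.1.apply j i
      simpa [K, mul_comm, mul_assoc, mul_left_comm, inner_smul_left, hc] using this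
  have : Fact K.PosSemidef := ⟨hK⟩
  refine ⟨RKHS.OfKernel K, inferInstance, inferInstance, inferInstance,
    fun x => RKHS.kerFun (RKHS.OfKernel K) x 1, fun x y => ?_, ?_⟩
  · rw [← RKHS.kernel_inner, RKHS.OfKernel.kernel_ofKernel]
    have := hM.1.apply x y
    simpa [K] using this
  · rw [eq_top_iff, ← RKHS.kerFun_dense (RKHS.OfKernel K)]
    refine Submodule.topologicalClosure_mono (Submodule.span_le.2 ?_)
    rintro _ ⟨x, v, rfl⟩
    have : RKHS.kerFun (RKHS.OfKernel K) x v = v • RKHS.kerFun (RKHS.OfKernel K) x 1 := by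
      rw [← map_smul]; simp
    rw [SetLike.mem_coe, this]
    exact Submodule.smul_mem _ _ (Submodule.subset_span ⟨x, rfl⟩)

variable {H : Type*} [NormedAddCommGroup H] [InnerProductSpace ℂ H]

theorem posSemidef_gram_family (v : X → H) : (gram ℂ v).PosSemidef :=
  posSemidef_of_fin_submatrix fun _ g => posSemidef_gram ℂ (v ∘ g)

theorem sum_star_mul_gram_mul (v : X → H) (c : X →₀ ℂ) :
    (c.sum fun i xi => c.sum fun j xj => star xi * gram ℂ v i j * xj) =
      ((‖Finsupp.linearCombination ℂ v c‖ ^ 2 : ℝ) : ℂ) := by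
  have h := inner_self_eq_norm_sq_to_K (𝕜 := ℂ) (Finsupp.linearCombination ℂ v c)
  rw [Complex.ofReal_pow]
  refine Eq.trans ?_ h
  simp only [Finsupp.linearCombination_apply, Finsupp.sum, sum_inner, inner_sum,
    inner_smul_left, inner_smul_right, gram_apply]
  simp only [Finset.mul_sum]
  conv_rhs => rw [Finset.sum_comm]
  refine Finset.sum_congr rfl fun i _ => Finset.sum_congr rfl fun j _ => ?_
  simp; ring

theorem norm_linearCombination_le_of_posSemidef {F : Type*} [NormedAddCommGroup F]
    [InnerProductSpace ℂ F] {v : X → H} {w : X → F} {C : ℝ}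
    (h : (C • gram ℂ v - gram ℂ w).PosSemidef) (c : X →₀ ℂ) :
    ‖Finsupp.linearCombination ℂ w c‖ ≤ √C * ‖Finsupp.linearCombination ℂ v c‖ := by
  have h1 := h.2 c
  have h2 : (c.sum fun i xi => c.sum fun j xj => star xi * (C • gram ℂ v - gram ℂ w) i j * xj) =
      ((C * ‖Finsupp.linearCombination ℂ v c‖ ^ 2 - ‖Finsupp.linearCombination ℂ w c‖ ^ 2 : ℝ) : ℂ)
      := by
    push_cast
    rw [← Complex.ofReal_pow, ← Complex.ofReal_pow, ← sum_star_mul_gram_mul,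
      ← sum_star_mul_gram_mul]
    simp only [Finsupp.sum, Finset.mul_sum, ← Finset.sum_sub_distrib, Matrix.sub_apply,
      Matrix.smul_apply, Complex.real_smul]
    refine Finset.sum_congr rfl fun i _ => Finset.sum_congr rfl fun j _ => ?_
    ring
  rw [h2, Complex.zero_le_real, sub_nonneg] at h1
  rcases le_or_gt 0 C with hC | hC
  · rw [← Real.sqrt_sq (norm_nonneg (Finsupp.linearCombination ℂ w c)),
      ← Real.sqrt_sq (norm_nonneg (Finsupp.linearCombination ℂ v c)), ← Real.sqrt_mul hC]
    exact Real.sqrt_le_sqrt h1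
  · have : ‖Finsupp.linearCombination ℂ w c‖ ^ 2 ≤ 0 :=
      h1.trans (mul_nonpos_of_nonpos_of_nonneg hC.le (sq_nonneg _))
    have : ‖Finsupp.linearCombination ℂ w c‖ = 0 := by
      simpa using le_antisymm this (sq_nonneg _)
    rw [this]; positivity

/-- A prescription on a total family extends to a bounded operator as soon as it is bounded on
finite linear combinations. -/
theorem exists_clm_of_norm_le {F : Type*} [NormedAddCommGroup F] [NormedSpace ℂ F]
    [CompleteSpace F] {v : X → H} {w : X → F} {C : ℝ}
    (hv : (Submodule.span ℂ (Set.range v)).topologicalClosure = ⊤)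
    (h : ∀ c, ‖Finsupp.linearCombination ℂ w c‖ ≤ C * ‖Finsupp.linearCombination ℂ v c‖) :
    ∃ T : H →L[ℂ] F, ∀ x, T (v x) = w x := by
  have hd : DenseRange (Finsupp.linearCombination ℂ v) := by
    rw [DenseRange, ← LinearMap.coe_range, Finsupp.range_linearCombination]
    exact Submodule.dense_iff_topologicalClosure_eq_top.2 hv
  refine ⟨(Finsupp.linearCombination ℂ w).extendOfNorm (Finsupp.linearCombination ℂ v),
    fun x => ?_⟩
  have := LinearMap.extendOfNorm_eq (f := Finsupp.linearCombination ℂ w) hd ⟨C, h⟩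
    (Finsupp.single x 1)
  simpa using this

theorem exists_clm_of_posSemidef {F : Type*} [NormedAddCommGroup F] [InnerProductSpace ℂ F]
    [CompleteSpace F] {v : X → H} {w : X → F} {C : ℝ}
    (hv : (Submodule.span ℂ (Set.range v)).topologicalClosure = ⊤)
    (h : (C • gram ℂ v - gram ℂ w).PosSemidef) :
    ∃ T : H →L[ℂ] F, ∀ x, T (v x) = w x :=
  exists_clm_of_norm_le hv (norm_linearCombination_le_of_posSemidef h)

/-- The operator norm of `∑ c x • |v x⟩⟨v x|` is at most its Hilbert–Schmidt norm, which is computed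
by any family `w` whose Gram matrix is the entrywise squared modulus of that of `v`. -/
theorem norm_linearCombination_rankOne_le (v : X → H) {K : Type*} [NormedAddCommGroup K]
    [InnerProductSpace ℂ K] {w : X → K}
    (hw : ∀ x y, ⟪w x, w y⟫_ℂ = ⟪v x, v y⟫_ℂ * ⟪v y, v x⟫_ℂ) (c : X →₀ ℂ) :
    ‖Finsupp.linearCombination ℂ (fun x => InnerProductSpace.rankOne ℂ (v x) (v x)) c‖ ≤
      ‖Finsupp.linearCombination ℂ w c‖ := by
  refine ContinuousLinearMap.opNorm_le_bound _ (norm_nonneg _) fun x => ?_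
  set A := Finsupp.linearCombination ℂ (fun x => InnerProductSpace.rankOne ℂ (v x) (v x)) c with hA
  set y := A x with hy
  -- With `y = A x`, the norm `‖y‖²` is a sum of entries of the Schur product of the Gram matrices
  -- of `(y, v)` and `(x, v)`, to which the Cauchy–Schwarz inequality applies.
  let p : Option X → H := fun o => o.elim y v
  let q : Option X → H := fun o => o.elim x v
  have hM : (gram ℂ p ⊙ (gram ℂ q)ᵀ).PosSemidef :=
    (posSemidef_gram_family p).hadamard (posSemidef_gram_family q).transpose
  obtain ⟨E, _, _, _, u, hu, -⟩ := exists_hilbert_of_posSemidef hM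
  have hn : ‖u none‖ = ‖x‖ * ‖y‖ := by
    have h1 : ((‖u none‖ ^ 2 : ℝ) : ℂ) = ((‖x‖ * ‖y‖) ^ 2 : ℝ) := by
      have := hu none none
      simp only [hadamard_apply, gram_apply, transpose_apply, p, q, Option.elim,
        inner_self_eq_norm_sq_to_K] at this
      push_cast
      rw [mul_pow, mul_comm]
      exact this
    have := Complex.ofReal_injective h1
    exact (sq_eq_sq₀ (norm_nonneg _) (by positivity)).1 this
  have hs : ‖Finsupp.linearCombination ℂ (fun i => u (some i)) c‖ =
      ‖Finsupp.linearCombination ℂ w c‖ := by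
    have h1 : gram ℂ (fun i => u (some i)) = gram ℂ w := by
      ext i j
      simp [gram_apply, hu, hw, p, q]
    have h2 := sum_star_mul_gram_mul (fun i => u (some i)) c
    rw [h1, sum_star_mul_gram_mul w c] at h2
    exact ((sq_eq_sq₀ (norm_nonneg _) (norm_nonneg _)).1 (Complex.ofReal_injective h2)).symm
  have hi : ⟪u none, Finsupp.linearCombination ℂ (fun i => u (some i)) c⟫_ℂ = ⟪y, y⟫_ℂ := by
    have hz : ∀ z, ⟪z, A x⟫_ℂ = ∑ i ∈ c.support, c i * (⟪v i, x⟫_ℂ * ⟪z, v i⟫_ℂ) := fun z => by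
      rw [hA, Finsupp.linearCombination_apply, Finsupp.sum]
      simp only [_root_.sum_apply, _root_.smul_apply, inner_sum, inner_smul_right,
        InnerProductSpace.rankOne_apply]
    rw [hz, Finsupp.linearCombination_apply, Finsupp.sum, inner_sum]
    refine Finset.sum_congr rfl fun i _ => ?_
    rw [inner_smul_right, hu]
    simp [p, q, gram_apply, mul_comm]
  have hcs := norm_inner_le_norm (𝕜 := ℂ) (u none)
    (Finsupp.linearCombination ℂ (fun i => u (some i)) c)
  rw [hi, hn, hs, inner_self_eq_norm_sq_to_K] at hcs
  rcases eq_or_ne y 0 with h0 | h0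
  · rw [h0]; simp; positivity
  · have : 0 < ‖y‖ := norm_pos_iff.2 h0
    refine le_of_mul_le_mul_right ?_ this
    simp at hcs
    linarith

theorem clm_eq_of_eqOn {F : Type*} [NormedAddCommGroup F] [NormedSpace ℂ F] {v : X → H}
    (hv : (Submodule.span ℂ (Set.range v)).topologicalClosure = ⊤) {S T : H →L[ℂ] F}
    (h : ∀ x, S (v x) = T (v x)) : S = T :=
  ContinuousLinearMap.ext_on (Submodule.dense_iff_topologicalClosure_eq_top.2 hv)
    (by rintro _ ⟨x, rfl⟩; exact h x)

end Kernel

/-! ### Traces and characters -/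

section Traces

open Matrix
open scoped ComplexOrder InnerProductSpace ComplexConjugate

variable {Λ : Type*} [Group Λ]

/-- The kernel `(g, h) ↦ φ (g⁻¹ h)` of a function on a group, as a matrix indexed by the group. -/
def kernelMatrix (φ : Λ → ℂ) : Matrix Λ Λ ℂ := .of fun g h => φ (g⁻¹ * h)

@[simp] theorem kernelMatrix_apply (φ : Λ → ℂ) (g h : Λ) : kernelMatrix φ g h = φ (g⁻¹ * h) := rfl

theorem isPositiveDefinite_iff {φ : Λ → ℂ} :
    IsPositiveDefinite φ ↔ (kernelMatrix φ).PosSemidef :=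
  ⟨fun h => posSemidef_of_fin_submatrix h, fun h _ g => h.submatrix g⟩

namespace IsPositiveDefinite

variable {φ τ : Λ → ℂ}

theorem map_inv (h : IsPositiveDefinite φ) (g : Λ) : φ g⁻¹ = conj (φ g) := by
  have := (isPositiveDefinite_iff.1 h).1.apply g 1
  simpa using this.symm

theorem map_one_nonneg (h : IsPositiveDefinite φ) : 0 ≤ φ 1 := by
  simpa using (isPositiveDefinite_iff.1 h).diag_nonneg (i := 1)

theorem map_one_eq (h : IsPositiveDefinite φ) : φ 1 = ((φ 1).re : ℂ) :=
  Complex.ext rfl (by simpa using (Complex.nonneg_iff.1 h.map_one_nonneg).2.symm)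

theorem norm_le (h : IsPositiveDefinite φ) (g : Λ) : ‖φ g‖ ≤ (φ 1).re := by
  obtain ⟨H, _, _, _, v, hv, -⟩ := exists_hilbert_of_posSemidef (isPositiveDefinite_iff.1 h)
  have hn : ∀ x, ‖v x‖ ^ 2 = (φ 1).re := fun x => by
    rw [← inner_self_eq_norm_sq (𝕜 := ℂ), hv]; simp
  have h1 := norm_inner_le_norm (𝕜 := ℂ) (v 1) (v g)
  rw [hv] at h1
  have h2 : ‖v g‖ = ‖v 1‖ := (sq_eq_sq₀ (norm_nonneg _) (norm_nonneg _)).1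
    ((hn g).trans (hn 1).symm)
  rw [h2, ← sq, hn] at h1
  simpa using h1

theorem add (h : IsPositiveDefinite φ) (h' : IsPositiveDefinite τ) : IsPositiveDefinite (φ + τ) :=
  fun n g => (h n g).add (h' n g)

theorem smul (h : IsPositiveDefinite φ) {r : ℝ} (hr : 0 ≤ r) : IsPositiveDefinite (r • φ) :=
  fun n g => (h n g).smul hr

theorem mul (h : IsPositiveDefinite φ) (h' : IsPositiveDefinite τ) : IsPositiveDefinite (φ * τ) :=
  fun n g => (h n g).hadamard (h' n g)

theorem star (h : IsPositiveDefinite φ) : IsPositiveDefinite (star φ) := fun n g => by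
  have := (h n g).transpose
  rw [show (of fun i j => (Star.star φ) ((g i)⁻¹ * g j)) =
    (of fun i j => φ ((g i)⁻¹ * g j))ᵀ from ?_]
  · exact this
  ext i j
  simp only [of_apply, transpose_apply, Pi.star_apply]
  rw [Complex.star_def, ← h.map_inv]
  simp

theorem comp {Γ : Type*} [Group Γ] (h : IsPositiveDefinite φ) (q : Γ →* Λ) :
    IsPositiveDefinite (φ ∘ q) := fun n g => by
  simpa using! h n (q ∘ g)

end IsPositiveDefinite

theorem isPositiveDefinite_gram {H : Type*} [NormedAddCommGroup H] [InnerProductSpace ℂ H]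
    {φ : Λ → ℂ} {w : Λ → H} (h : ∀ x y, ⟪w x, w y⟫_ℂ = φ (x⁻¹ * y)) : IsPositiveDefinite φ := by
  rw [isPositiveDefinite_iff]
  convert posSemidef_gram_family w using 1
  ext x y
  simp [h, gram_apply]

/-- Extremality in terms of domination: a conjugation-invariant positive definite function below a
multiple of a character is a multiple of it. -/
theorem eq_smul_of_dominated {φ τ : Λ → ℂ} (hφ : φ ∈ characters Λ) (hτ : IsPositiveDefinite τ)
    (hc : ∀ g h : Λ, τ (h * g * h⁻¹) = τ g) {K : ℝ} (hK : IsPositiveDefinite (K • φ - τ)) :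
    τ = τ 1 • φ := by
  obtain ⟨⟨h1, h2, h3⟩, hext⟩ := mem_extremePoints.1 hφ
  set t := (τ 1).re with ht
  have h1t : τ 1 = (t : ℂ) := hτ.map_one_eq
  have ht0 : 0 ≤ t := (Complex.nonneg_iff.1 hτ.map_one_nonneg).1
  rcases ht0.eq_or_lt with h0 | h0
  · ext g
    have : ‖τ g‖ ≤ 0 := h0 ▸ hτ.norm_le g
    rw [h1t, ← h0]
    simpa using this
  -- A constant `L > t` with `L ≥ K` gives both summands of `φ = L⁻¹ τ + L⁻¹ (L φ - τ)` positive
  -- total mass.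
  set L := |K| + t + 1 with hL
  have hLK : 0 ≤ L - K := by have := le_abs_self K; linarith
  have hLt : 0 < L - t := by have := abs_nonneg K; linarith
  have hL0 : 0 < L := by linarith
  have hd : IsPositiveDefinite (L • φ - τ) := by
    have := hK.add (h1.smul hLK)
    convert this using 1
    module
  have hA : t⁻¹ • τ ∈ traces Λ := by
    refine ⟨hτ.smul (by positivity), ?_, fun g h => by simp [hc]⟩
    simp [h1t, h0.ne']
  have hB : (L - t)⁻¹ • (L • φ - τ) ∈ traces Λ := by
    refine ⟨hd.smul (by positivity), ?_, fun g h => by simp [hc, h3]⟩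
    have : ((L : ℂ) - t) ≠ 0 := by exact_mod_cast hLt.ne'
    simp [h1t, h2, this]
  have := hext _ hA _ hB ⟨t / L, (L - t) / L, by positivity, by positivity,
    by field_simp; ring, by
    rw [smul_smul, smul_smul]
    have e1 : t / L * t⁻¹ = L⁻¹ := by field_simp
    have e2 : (L - t) / L * (L - t)⁻¹ = L⁻¹ := by field_simp
    rw [e1, e2, smul_sub, smul_smul, inv_mul_cancel₀ hL0.ne']
    module⟩
  rw [← this.1, h1t]
  ext g
  simp [h0.ne']

/-- Characters are multiplicative along the center, a form of Schur's lemma. -/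
theorem map_mul_of_mem_center {φ : Λ → ℂ} (hφ : φ ∈ characters Λ) {c : Λ}
    (hc : c ∈ Subgroup.center Λ) (g : Λ) : φ (g * c) = φ g * φ c := by
  obtain ⟨h1, h2, h3⟩ := hφ.1
  have hcc : ∀ g, g * c = c * g := fun g => (Subgroup.mem_center_iff.1 hc g)
  have hci : ∀ g, g * c⁻¹ = c⁻¹ * g := fun g =>
    (Subgroup.mem_center_iff.1 (inv_mem hc) g)
  obtain ⟨H, _, _, _, v, hv, -⟩ := exists_hilbert_of_posSemidef (isPositiveDefinite_iff.1 h1)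
  -- `T ε` is the kernel of the vectors `v g + ε v (g c)`; the cases `ε = 1` and `ε = I` separate
  -- the two summands `φ (g c)` and `φ (g c⁻¹)`.
  let T : ℂ → Λ → ℂ := fun ε g => 2 * φ g + ε * φ (g * c) + conj ε * φ (g * c⁻¹)
  have hT : ∀ ε : ℂ, ε * conj ε = 1 → IsPositiveDefinite (T ε) := fun ε hε => by
    refine isPositiveDefinite_gram (w := fun g => v g + ε • v (g * c)) fun x y => ?_
    simp only [inner_add_left, inner_add_right, inner_smul_left, inner_smul_right, hv,
      kernelMatrix_apply, T]
    have e1 : (x * c)⁻¹ * y = x⁻¹ * y * c⁻¹ := by rw [hci, _root_.mul_inv_rev, mul_assoc]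
    have e2 : (x * c)⁻¹ * (y * c) = x⁻¹ * y := by rw [← mul_assoc, e1]; group
    rw [e1, e2, ← mul_assoc x⁻¹ y c]
    linear_combination φ (x⁻¹ * y) * hε
  have hTe : ∀ ε : ℂ, ε * conj ε = 1 → T ε = T ε 1 • φ := fun ε hε => by
    refine eq_smul_of_dominated hφ (hT ε hε) (fun g h => ?_) (K := 4) ?_
    · have e1 : h * g * h⁻¹ * c = h * (g * c) * h⁻¹ := by
        rw [hcc, hcc g]; simp only [← mul_assoc, hcc h]
      have e2 : h * g * h⁻¹ * c⁻¹ = h * (g * c⁻¹) * h⁻¹ := by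
        rw [hci, hci g]; simp only [← mul_assoc, hci h]
      simp only [T, e1, e2, h3]
    · convert hT (-ε) (by simpa using hε) using 1
      ext g
      simp [T]
      ring
  have a1 := congrFun (hTe 1 (by simp)) g
  have a2 := congrFun (hTe Complex.I (by simp)) g
  simp only [T, Pi.smul_apply, smul_eq_mul, map_one, one_mul, h2, Complex.conj_I] at a1 a2
  have hI : Complex.I * Complex.I = -1 := Complex.I_mul_I
  linear_combination (a1 - Complex.I * a2) / 2 +
    (φ (g * c) - φ (g * c⁻¹) - φ g * φ c + φ g * φ c⁻¹) / 2 * hI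

theorem norm_eq_one_of_mem_center {φ : Λ → ℂ} (hφ : φ ∈ characters Λ) {c : Λ}
    (hc : c ∈ Subgroup.center Λ) : ‖φ c‖ = 1 := by
  have h := map_mul_of_mem_center hφ hc c⁻¹
  rw [inv_mul_cancel, hφ.1.2.1, hφ.1.1.map_inv, mul_comm, Complex.mul_conj,
    Complex.normSq_eq_norm_sq] at h
  have : ‖φ c‖ ^ 2 = 1 := by exact_mod_cast h.symm
  exact (pow_eq_one_iff_of_nonneg (norm_nonneg _) two_ne_zero).1 this

/-- If a trace attains its maximum `1` at `c`, then the vectors of `c` and `1` in the GNS space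
coincide. -/
theorem map_mul_of_map_eq_one {φ : Λ → ℂ} (hφ : φ ∈ traces Λ) {c : Λ} (hc : φ c = 1) (g : Λ) :
    φ (g * c) = φ g := by
  obtain ⟨h1, h2, h3⟩ := hφ
  obtain ⟨H, _, _, _, v, hv, -⟩ := exists_hilbert_of_posSemidef (isPositiveDefinite_iff.1 h1)
  have h0 : v c - v 1 = 0 := by
    rw [← inner_self_eq_zero (𝕜 := ℂ)]
    rw [inner_sub_left, inner_sub_right, inner_sub_right]
    simp [-inner_self_eq_norm_sq_to_K, hv, h2, hc, h1.map_inv]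
  have := hv g⁻¹ c
  rw [sub_eq_zero.1 h0, hv] at this
  simpa using this.symm

end Traces

/-! ### Choquet's theorem for compact sets with countably many separating functionals -/

section Choquet

open Set MeasureTheory CompactlySupported

/-- The Riesz–Markov–Kakutani theorem on a compact space, stated for all continuous functions. -/
theorem exists_measure_of_positive_functional {X : Type*} [TopologicalSpace X] [CompactSpace X]
    [T2Space X] [MeasurableSpace X] [BorelSpace X] (m : C(X, ℝ) →ₗ[ℝ] ℝ)
    (hpos : ∀ f : C(X, ℝ), (∀ x, 0 ≤ f x) → 0 ≤ m f) :
    ∃ μ : Measure X, IsFiniteMeasure μ ∧ ∀ f : C(X, ℝ), ∫ x, f x ∂μ = m f := by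
  let P : C_c(X, ℝ) →ₚ[ℝ] ℝ :=
    { toFun := fun f => m f
      map_add' := fun f g => by rw [← map_add]; rfl
      map_smul' := fun c f => by rw [RingHom.id_apply, ← map_smul]; rfl
      monotone' := fun f g hfg => by
        have := hpos ((g : C(X, ℝ)) - f) fun x => sub_nonneg.2 (hfg x)
        rw [map_sub] at this
        exact sub_nonneg.1 this }
  refine ⟨RealRMK.rieszMeasure P, inferInstance, fun f => ?_⟩
  exact RealRMK.integral_rieszMeasure P ⟨f, HasCompactSupport.of_compactSpace _⟩

variable {E : Type*} [AddCommGroup E] [Module ℝ E] [TopologicalSpace E]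

/-- The values at `x` of the continuous affine functions `l + c` that majorize `g` on `X`. -/
def affineMajorantValues (X : Set E) (g : X → ℝ) (x : E) : Set ℝ :=
  {r | ∃ (l : E →L[ℝ] ℝ) (c : ℝ), (∀ y : X, g y ≤ l y + c) ∧ r = l x + c}

/-- The upper envelope of `g : X → ℝ` at `x`: the infimum of the values at `x` of the continuous
affine majorants of `g` on `X`. -/
def upperEnvelope (X : Set E) (g : X → ℝ) (x : E) : ℝ := sInf (affineMajorantValues X g x)

variable {X : Set E}

theorem le_of_mem_affineMajorantValues {g : X → ℝ} {x : X} {r : ℝ}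
    (hr : r ∈ affineMajorantValues X g x) : g x ≤ r := by
  obtain ⟨l, c, h, rfl⟩ := hr
  exact h x

theorem bddBelow_affineMajorantValues (g : X → ℝ) (x : X) :
    BddBelow (affineMajorantValues X g x) :=
  ⟨g x, fun _ hr => le_of_mem_affineMajorantValues hr⟩

theorem nonempty_affineMajorantValues [CompactSpace X] (g : C(X, ℝ)) (x : X) :
    (affineMajorantValues X g x).Nonempty :=
  ⟨_, 0, ‖g‖, fun y => by simpa using (le_abs_self _).trans (g.norm_coe_le_norm y), rfl⟩

theorem upperEnvelope_le {g : X → ℝ} {l : E →L[ℝ] ℝ} {c : ℝ} (h : ∀ y : X, g y ≤ l y + c) (x : X) :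
    upperEnvelope X g x ≤ l x + c :=
  csInf_le (bddBelow_affineMajorantValues g x) ⟨l, c, h, rfl⟩

theorem le_upperEnvelope [CompactSpace X] (g : C(X, ℝ)) (x : X) : g x ≤ upperEnvelope X g x :=
  le_csInf (nonempty_affineMajorantValues g x) fun _ hr => le_of_mem_affineMajorantValues hr

theorem exists_lt_upperEnvelope_add [CompactSpace X] (g : C(X, ℝ)) (x : X) {ε : ℝ} (hε : 0 < ε) :
    ∃ (l : E →L[ℝ] ℝ) (c : ℝ), (∀ y : X, g y ≤ l y + c) ∧ l x + c < upperEnvelope X g x + ε := by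
  obtain ⟨_, ⟨l, c, h, rfl⟩, hlt⟩ := exists_lt_of_csInf_lt (nonempty_affineMajorantValues g x)
    (lt_add_of_pos_right (upperEnvelope X g x) hε)
  exact ⟨l, c, h, hlt⟩

theorem upperEnvelope_add_le [CompactSpace X] [IsTopologicalAddGroup E] [ContinuousSMul ℝ E]
    (f g : C(X, ℝ)) (x : X) :
    upperEnvelope X (f + g : C(X, ℝ)) x ≤ upperEnvelope X f x + upperEnvelope X g x := by
  refine le_of_forall_pos_le_add fun ε hε => ?_
  obtain ⟨l, c, h, hl⟩ := exists_lt_upperEnvelope_add f x (half_pos hε)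
  obtain ⟨l', c', h', hl'⟩ := exists_lt_upperEnvelope_add g x (half_pos hε)
  have := upperEnvelope_le (g := (f + g : C(X, ℝ))) (l := l + l') (c := c + c') (fun y => by
    have := h y; have := h' y
    simp only [ContinuousMap.add_apply, FunLike.coe_add, Pi.add_apply]; linarith) x
  simp only [FunLike.coe_add, Pi.add_apply] at this
  simp only [ContinuousMap.coe_add] at this ⊢
  linarith

theorem upperEnvelope_smul [CompactSpace X] [IsTopologicalAddGroup E] [ContinuousSMul ℝ E]
    (g : C(X, ℝ)) (x : X) {a : ℝ} (ha : 0 < a) :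
    upperEnvelope X (a • g : C(X, ℝ)) x = a * upperEnvelope X g x := by
  have key : ∀ (g : C(X, ℝ)) {a : ℝ}, 0 < a →
      upperEnvelope X (a • g : C(X, ℝ)) x ≤ a * upperEnvelope X g x := fun g a ha => by
    rw [← div_le_iff₀' ha]
    refine le_csInf (nonempty_affineMajorantValues g x) ?_
    rintro _ ⟨l, c, h, rfl⟩
    rw [div_le_iff₀' ha]
    have := upperEnvelope_le (g := (a • g : C(X, ℝ))) (l := a • l) (c := a * c) (fun y => by
      have := mul_le_mul_of_nonneg_left (h y) ha.le
      simpa [mul_add] using this) x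
    simpa [mul_add] using this
  refine le_antisymm (key g ha) ?_
  have := key (a • g) (inv_pos.2 ha)
  rw [smul_smul, inv_mul_cancel₀ ha.ne', one_smul] at this
  rwa [← div_eq_inv_mul, le_div_iff₀' ha] at this

/-- The upper envelope is concave. -/
theorem combo_upperEnvelope_le [CompactSpace X] (g : C(X, ℝ)) {x y z : X} {a b : ℝ}
    (ha : 0 ≤ a) (hb : 0 ≤ b) (hab : a + b = 1) (h : a • (x : E) + b • (y : E) = z) :
    a * upperEnvelope X g x + b * upperEnvelope X g y ≤ upperEnvelope X g z := by
  refine le_csInf (nonempty_affineMajorantValues g z) ?_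
  rintro _ ⟨l, c, hl, rfl⟩
  have h1 := mul_le_mul_of_nonneg_left (upperEnvelope_le hl x) ha
  have h2 := mul_le_mul_of_nonneg_left (upperEnvelope_le hl y) hb
  rw [← h, map_add, map_smul, map_smul, smul_eq_mul, smul_eq_mul]
  have : c = a * c + b * c := by rw [← add_mul, hab, one_mul]
  linarith

/-- Hahn–Banach for the sublinear functional `g ↦ upperEnvelope X g x`, extending from the line
spanned by `f`. -/
theorem exists_functional_eq_upperEnvelope [CompactSpace X] [IsTopologicalAddGroup E]
    [ContinuousSMul ℝ E] (f : C(X, ℝ)) (x : X) :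
    ∃ m : C(X, ℝ) →ₗ[ℝ] ℝ, (∀ g : C(X, ℝ), m g ≤ upperEnvelope X g x) ∧
      m f = upperEnvelope X f x := by
  let N : C(X, ℝ) → ℝ := fun g => upperEnvelope X g x
  have hN0 : N 0 = 0 := by
    refine le_antisymm ?_ (le_upperEnvelope 0 x)
    exact (upperEnvelope_le (g := (0 : C(X, ℝ))) (l := 0) (c := 0) (fun y => by simp) x).trans
      (by simp)
  let P : C(X, ℝ) →ₗ.[ℝ] ℝ := LinearPMap.mkSpanSingleton' f (N f) fun a ha => by
    rcases smul_eq_zero.1 ha with h | h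
    · simp [h]
    · simp [h, hN0]
  -- For negative `a`, the bound `a N(f) ≤ N(a f)` follows from `0 = N(0) ≤ N(a f) + N(-a f)`.
  obtain ⟨m, hm, hle⟩ := exists_extension_of_le_sublinear P N
    (fun a ha g => upperEnvelope_smul g x ha) (fun g h => upperEnvelope_add_le g h x) (by
      rintro ⟨y, hy⟩
      obtain ⟨a, rfl⟩ := Submodule.mem_span_singleton.1 hy
      rw [LinearPMap.mkSpanSingleton'_apply]
      change a • N f ≤ N (a • f)
      rcases lt_trichotomy a 0 with h | rfl | h
      · have h1 : N (a • f + (-a) • f) ≤ N (a • f) + N ((-a) • f) :=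
          upperEnvelope_add_le (a • f) ((-a) • f) x
        have h2 : N ((-a) • f) = -a * N f := upperEnvelope_smul f x (neg_pos.2 h)
        rw [← add_smul, add_neg_cancel, zero_smul, hN0, h2] at h1
        rw [smul_eq_mul]
        linarith
      · simp [hN0]
      · exact (upperEnvelope_smul f x h).ge)
  refine ⟨m, hle, ?_⟩
  have := hm ⟨f, Submodule.mem_span_singleton_self f⟩
  rw [this]
  exact LinearPMap.mkSpanSingleton'_apply_self _ _ _ _

/-- There is a probability measure with barycenter `x` against which `f` has the largest possible
integral, its upper envelope at `x`. -/
theorem exists_measure_integral_eq_upperEnvelope [CompactSpace X] [T2Space X]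
    [IsTopologicalAddGroup E] [ContinuousSMul ℝ E] [MeasurableSpace X] [BorelSpace X]
    (f : C(X, ℝ)) (x : X) :
    ∃ μ : Measure X, IsProbabilityMeasure μ ∧ (∀ l : E →L[ℝ] ℝ, ∫ y, l y ∂μ = l x) ∧
      ∫ y, f y ∂μ = upperEnvelope X f x := by
  obtain ⟨m, hm, hmf⟩ := exists_functional_eq_upperEnvelope f x
  have haff : ∀ (l : E →L[ℝ] ℝ) (c : ℝ) (g : C(X, ℝ)), (∀ y, g y = l y + c) → m g = l x + c := by
    intro l c g hg
    refine le_antisymm ((hm g).trans (upperEnvelope_le (fun y => (hg y).le) x)) ?_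
    have := (hm (-g)).trans (upperEnvelope_le (l := -l) (c := -c)
      (fun y => by simp [hg, add_comm]) x)
    simp at this
    linarith
  obtain ⟨μ, hμ, hint⟩ := exists_measure_of_positive_functional m fun g hg => by
    have := (hm (-g)).trans (upperEnvelope_le (l := 0) (c := 0) (fun y => by simpa using hg y) x)
    simpa using this
  refine ⟨μ, ⟨?_⟩, fun l => ?_, by rw [hint, hmf]⟩
  · have := hint 1
    rw [haff 0 1 1 (by simp)] at this
    simpa [Measure.real, ENNReal.toReal_eq_one_iff] using this
  · have := hint ⟨fun y : X => l y, by fun_prop⟩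
    rw [haff l 0 _ (by simp)] at this
    simpa using this

/-- A measure with barycenter `x` that attains the upper envelope of `f` at `x` is concentrated
where `f` meets its envelope. -/
theorem ae_eq_upperEnvelope [CompactSpace X] [MeasurableSpace X] [BorelSpace X]
    {f : C(X, ℝ)} {x : X} {μ : Measure X} [IsProbabilityMeasure μ]
    (hμ : ∀ l : E →L[ℝ] ℝ, ∫ y, l y ∂μ = l x) (hf : ∫ y, f y ∂μ = upperEnvelope X f x) :
    ∀ᵐ y : X ∂μ, upperEnvelope X f y = f y := by
  choose l c hlc hlt using fun n : ℕ =>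
    exists_lt_upperEnvelope_add f x (ε := 1 / ((n : ℝ) + 1)) (by positivity)
  -- The envelope need not be measurable; a countable infimum `G` of affine majorants that are
  -- nearly optimal at `x` lies above it.
  let G : X → ℝ := fun y => ⨅ n, (l n y + c n)
  have hbdd : ∀ y : X, BddBelow (range fun n => l n y + c n) := fun y =>
    ⟨f y, by rintro _ ⟨n, rfl⟩; exact hlc n y⟩
  have hfG : ∀ y, f y ≤ G y := fun y => le_ciInf fun n => hlc n y
  have hGl : ∀ n y, G y ≤ l n y + c n := fun n y => ciInf_le (hbdd y) n
  have hint : ∀ g : C(X, ℝ), Integrable g μ := fun g =>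
    (BoundedContinuousFunction.mkOfCompact g).integrable μ
  have hl : ∀ n, Integrable (fun y : X => l n y + c n) μ := fun n =>
    hint ⟨fun y : X => l n y + c n, by fun_prop⟩
  have hGm : Measurable G := Measurable.iInf fun n => by
    have : Continuous fun y : X => l n y + c n := by fun_prop
    exact this.measurable
  have hGi : Integrable G μ := by
    refine Integrable.mono' ((hint f).norm.add (hl 0).norm) hGm.aestronglyMeasurable ?_
    refine .of_forall fun y => ?_
    simp only [Pi.add_apply, Real.norm_eq_abs]
    have h1 := hfG y
    have h2 := hGl 0 y
    rw [abs_le]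
    constructor
    · linarith [neg_abs_le (f y), abs_nonneg (l 0 y + c 0)]
    · linarith [le_abs_self (l 0 y + c 0), abs_nonneg (f y)]
  have hGle : ∫ y, G y ∂μ ≤ ∫ y, f y ∂μ := by
    rw [hf]
    refine le_of_forall_pos_le_add fun ε hε => ?_
    obtain ⟨n, hn⟩ := exists_nat_one_div_lt hε
    have h1 : ∫ y, G y ∂μ ≤ ∫ y : X, (l n y + c n) ∂μ := integral_mono hGi (hl n) (hGl n)
    have h2 : ∫ y : X, (l n y + c n) ∂μ = l n x + c n := by
      rw [integral_add (f := fun y : X => l n y) (hint ⟨fun y : X => l n y, by fun_prop⟩)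
        (integrable_const _), hμ]
      simp
    linarith [hlt n]
  have h0 : ∫ y, (G y - f y) ∂μ = 0 := by
    rw [integral_sub hGi (hint f)]
    exact le_antisymm (by linarith) (sub_nonneg.2 (integral_mono (hint f) hGi hfG))
  have := (integral_eq_zero_iff_of_nonneg (fun y => sub_nonneg.2 (hfG y)) (hGi.sub (hint f))).1 h0
  filter_upwards [this] with y hy
  refine le_antisymm ?_ (le_upperEnvelope f y)
  have h3 : G y = f y := sub_eq_zero.1 hy
  rw [← h3]
  exact le_ciInf fun n => upperEnvelope_le (hlc n) y

/-- **Choquet's theorem** for a compact set on which countably many continuous functionals separate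
points: every point is the barycenter of a probability measure concentrated on the extreme points.
The measure maximizes the integral of the strictly convex function `f = ∑ n, 2⁻ⁿ (l n)²`, and `f`
meets its upper envelope only in extreme points. -/
theorem exists_measure_ae_mem_extremePoints [T2Space E] [IsTopologicalAddGroup E]
    [ContinuousSMul ℝ E] [MeasurableSpace X] [BorelSpace X] (hX : IsCompact X)
    {l : ℕ → E →L[ℝ] ℝ} (hl : ∀ n, ∀ x ∈ X, |l n x| ≤ 1)
    (hsep : ∀ x ∈ X, ∀ y ∈ X, (∀ n, l n x = l n y) → x = y) (x : X) :
    ∃ μ : Measure X, IsProbabilityMeasure μ ∧ (∀ f : E →L[ℝ] ℝ, ∫ y, f y ∂μ = f x) ∧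
      ∀ᵐ y : X ∂μ, (y : E) ∈ X.extremePoints ℝ := by
  have : CompactSpace X := isCompact_iff_compactSpace.1 hX
  have hb : ∀ n (y : X), ‖(1 / 2 : ℝ) ^ n * (l n y) ^ 2‖ ≤ (1 / 2 : ℝ) ^ n := fun n y => by
    rw [norm_mul, norm_pow, norm_pow]
    have : |l n y| ^ 2 ≤ 1 := pow_le_one₀ (abs_nonneg _) (hl n y y.2)
    simpa using mul_le_mul_of_nonneg_left this (by positivity : (0:ℝ) ≤ (1 / 2) ^ n)
  have hs : ∀ y : X, Summable fun n => (1 / 2 : ℝ) ^ n * (l n y) ^ 2 := fun y =>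
    Summable.of_norm_bounded summable_geometric_two (hb · y)
  -- a strictly convex function
  let f : C(X, ℝ) := ⟨fun y => ∑' n, (1 / 2 : ℝ) ^ n * (l n y) ^ 2,
    continuous_tsum (fun n => by fun_prop) summable_geometric_two hb⟩
  obtain ⟨μ, hμ, hrep, hint⟩ := exists_measure_integral_eq_upperEnvelope f x
  refine ⟨μ, hμ, hrep, ?_⟩
  filter_upwards [ae_eq_upperEnvelope hrep hint] with z hz
  refine mem_extremePoints_iff_left.2 ⟨z.2, ?_⟩
  rintro x₁ h₁ x₂ h₂ ⟨a, b, ha, hb', hab, hz'⟩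
  have h1 := combo_upperEnvelope_le f (x := ⟨x₁, h₁⟩) (y := ⟨x₂, h₂⟩) (z := z) ha.le hb'.le hab hz'
  rw [hz] at h1
  have h2 := mul_le_mul_of_nonneg_left (le_upperEnvelope f ⟨x₁, h₁⟩) ha.le
  have h3 := mul_le_mul_of_nonneg_left (le_upperEnvelope f ⟨x₂, h₂⟩) hb'.le
  -- the convexity defect of `f` at `z = a x₁ + b x₂`
  have h4 : HasSum (fun n => a * b * ((1 / 2 : ℝ) ^ n * (l n x₁ - l n x₂) ^ 2))
      (a * f ⟨x₁, h₁⟩ + b * f ⟨x₂, h₂⟩ - f z) := by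
    have e : ∀ n, a * b * ((1 / 2 : ℝ) ^ n * (l n x₁ - l n x₂) ^ 2) =
        a * ((1 / 2 : ℝ) ^ n * (l n x₁) ^ 2) + b * ((1 / 2 : ℝ) ^ n * (l n x₂) ^ 2) -
          (1 / 2 : ℝ) ^ n * (l n z) ^ 2 := fun n => ?_
    · rw [funext e]
      exact (((hs ⟨x₁, h₁⟩).hasSum.mul_left a).add ((hs ⟨x₂, h₂⟩).hasSum.mul_left b)).sub
        (hs z).hasSum
    rw [← hz', map_add, map_smul, map_smul, smul_eq_mul, smul_eq_mul]
    obtain rfl : b = 1 - a := by linarith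
    ring
  have h5 : ∀ n, 0 ≤ a * b * ((1 / 2 : ℝ) ^ n * (l n x₁ - l n x₂) ^ 2) := fun n => by positivity
  have h6 : ∀ n, l n x₁ = l n x₂ := fun n => by
    have := le_hasSum h4 n fun k _ => h5 k
    have h0 : a * b * ((1 / 2 : ℝ) ^ n * (l n x₁ - l n x₂) ^ 2) = 0 :=
      le_antisymm (by linarith) (h5 n)
    have : (l n x₁ - l n x₂) ^ 2 = 0 := by
      simpa [ha.ne', hb'.ne'] using h0
    exact sub_eq_zero.1 (pow_eq_zero_iff two_ne_zero |>.1 this)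
  have h7 := hsep _ h₁ _ h₂ h6
  rw [← hz', ← h7, ← add_smul, hab, one_smul]

end Choquet

/-! ### Integral decomposition of traces -/

section Decomposition

open Matrix MeasureTheory
open scoped ComplexOrder ComplexConjugate

variable {Γ : Type*} [Group Γ]

/-- The functional `τ ↦ Re ∑ i j, conj (x i) τ (gᵢ⁻¹ gⱼ) x j`, by which positive definiteness is
tested. -/
def realQuadraticForm {n : ℕ} (g : Fin n → Γ) (x : Fin n → ℂ) : (Γ → ℂ) →L[ℝ] ℝ where
  toFun τ := (∑ i, ∑ j, conj (x i) * τ ((g i)⁻¹ * g j) * x j).re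
  map_add' τ τ' := by simp [mul_add, add_mul, Finset.sum_add_distrib]
  map_smul' r τ := by
    rw [RingHom.id_apply, smul_eq_mul, ← Complex.re_ofReal_mul]
    simp only [Finset.mul_sum, Pi.smul_apply, Complex.real_smul]
    congr 1
    refine Finset.sum_congr rfl fun i _ => Finset.sum_congr rfl fun j _ => by ring
  cont := by fun_prop

theorem star_dotProduct_mulVec_eq {n : ℕ} (g : Fin n → Γ) (x : Fin n → ℂ) (τ : Γ → ℂ) :
    star x ⬝ᵥ (Matrix.of fun i j : Fin n => τ ((g i)⁻¹ * g j)) *ᵥ x =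
      ∑ i, ∑ j, conj (x i) * τ ((g i)⁻¹ * g j) * x j := by
  simp [dotProduct, mulVec, Finset.mul_sum, mul_assoc]

theorem isPositiveDefinite_iff_realQuadraticForm {τ : Γ → ℂ} :
    IsPositiveDefinite τ ↔ (∀ g, τ g⁻¹ = conj (τ g)) ∧
      ∀ (n : ℕ) (g : Fin n → Γ) (x : Fin n → ℂ), 0 ≤ realQuadraticForm g x τ := by
  refine ⟨fun h => ⟨h.map_inv, fun n g x => ?_⟩, fun ⟨h1, h2⟩ n g => ?_⟩
  · have := (Complex.nonneg_iff.1 ((h n g).dotProduct_mulVec_nonneg x)).1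
    rwa [star_dotProduct_mulVec_eq] at this
  · have hH : (Matrix.of fun i j : Fin n => τ ((g i)⁻¹ * g j)).IsHermitian := by
      ext i j
      simp [← h1]
    refine .of_dotProduct_mulVec_nonneg hH fun x => Complex.nonneg_iff.2 ⟨?_, ?_⟩
    · rw [star_dotProduct_mulVec_eq]
      exact h2 n g x
    · exact (hH.im_star_dotProduct_mulVec_self x).symm

theorem isClosed_traces : IsClosed (traces Γ) := by
  have : traces Γ = {τ | ∀ g, τ g⁻¹ = conj (τ g)} ∩
      (⋂ (n : ℕ) (g : Fin n → Γ) (x : Fin n → ℂ), {τ | 0 ≤ realQuadraticForm g x τ}) ∩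
      {τ | τ 1 = 1} ∩ {τ | ∀ g h, τ (h * g * h⁻¹) = τ g} := by
    ext τ
    simp [traces, isPositiveDefinite_iff_realQuadraticForm, and_assoc]
  rw [this]
  refine IsClosed.inter (IsClosed.inter (IsClosed.inter ?_ ?_) ?_) ?_
  · simp only [Set.ofPred_forall]
    exact isClosed_iInter fun g => isClosed_eq (by fun_prop) (by fun_prop)
  · exact isClosed_iInter fun n => isClosed_iInter fun g => isClosed_iInter fun x =>
      isClosed_le (by fun_prop) (by fun_prop)
  · exact isClosed_eq (by fun_prop) (by fun_prop)
  · simp only [Set.ofPred_forall]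
    exact isClosed_iInter fun g => isClosed_iInter fun h => isClosed_eq (by fun_prop) (by fun_prop)

theorem norm_le_one_of_mem_traces {τ : Γ → ℂ} (hτ : τ ∈ traces Γ) (g : Γ) : ‖τ g‖ ≤ 1 := by
  simpa [hτ.2.1] using hτ.1.norm_le g

theorem isCompact_traces : IsCompact (traces Γ) := by
  refine (isCompact_univ_pi fun _ : Γ => isCompact_closedBall (0 : ℂ) 1).of_isClosed_subset
    isClosed_traces fun τ hτ g _ => ?_
  simpa using norm_le_one_of_mem_traces hτ g

/-- Every trace on a countable group is an integral of characters. -/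
theorem exists_measure_characters [Countable Γ] (ψ : traces Γ) :
    ∃ μ : Measure (traces Γ), IsProbabilityMeasure μ ∧
      (∀ f : (Γ → ℂ) →L[ℝ] ℝ, ∫ τ, f τ ∂μ = f ψ) ∧
      ∀ᵐ τ : traces Γ ∂μ, (τ : Γ → ℂ) ∈ characters Γ := by
  obtain ⟨e, he⟩ := exists_surjective_nat (Γ × Bool)
  let p : Γ → (Γ → ℂ) →L[ℝ] ℂ := fun g =>
    ContinuousLinearMap.proj (R := ℝ) (φ := fun _ : Γ => ℂ) g
  let l : ℕ → (Γ → ℂ) →L[ℝ] ℝ := fun n =>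
    if (e n).2 then Complex.reCLM ∘L p (e n).1 else Complex.imCLM ∘L p (e n).1
  refine exists_measure_ae_mem_extremePoints isCompact_traces (l := l) (fun n τ hτ => ?_)
    (fun τ _ τ' _ h => ?_) ψ
  · have := norm_le_one_of_mem_traces hτ (e n).1
    by_cases hb : (e n).2
    · simpa [l, hb, p] using (Complex.abs_re_le_norm _).trans this
    · simpa [l, hb, p] using (Complex.abs_im_le_norm _).trans this
  · ext g
    obtain ⟨n, hn⟩ := he (g, true)
    obtain ⟨m, hm⟩ := he (g, false)
    exact Complex.ext (by simpa [l, hn, p] using h n) (by simpa [l, hm, p] using h m)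

/-- If all characters outside a countable set `S` vanish at `g`, then a trace either dominates a
positive multiple of an element of `S` or vanishes at `g`. -/
theorem exists_dominated_or_vanishing [Countable Γ] {ψ : Γ → ℂ} (hψ : ψ ∈ traces Γ)
    {S : Set (Γ → ℂ)} (hS : S.Countable) {g : Γ}
    (hg : ∀ χ ∈ characters Γ, χ ∉ S → χ g = 0) :
    (∃ χ ∈ S, ∃ a : ℝ, 0 < a ∧ IsPositiveDefinite (ψ - a • χ)) ∨ ψ g = 0 := by
  obtain ⟨μ, hμ, hrep, hae⟩ := exists_measure_characters ⟨ψ, hψ⟩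
  have hint : ∀ f : (Γ → ℂ) →L[ℝ] ℝ, Integrable (fun τ : traces Γ => f τ) μ := fun f => by
    have : CompactSpace (traces Γ) := isCompact_iff_compactSpace.1 isCompact_traces
    exact (BoundedContinuousFunction.mkOfCompact
      (⟨fun τ : traces Γ => f τ, by fun_prop⟩ : C(traces Γ, ℝ))).integrable μ
  by_cases h : ∃ χ : traces Γ, (χ : Γ → ℂ) ∈ S ∧ μ {χ} ≠ 0
  · obtain ⟨χ, hχ, hμχ⟩ := h
    -- An atom `χ` of `μ` contributes the summand `μ {χ} • χ` to `ψ`.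
    refine .inl ⟨χ, hχ, μ.real {χ}, ?_, ?_⟩
    · exact ENNReal.toReal_pos hμχ (measure_ne_top _ _)
    · refine isPositiveDefinite_iff_realQuadraticForm.2 ⟨fun g => ?_, fun n g x => ?_⟩
      · simp [hψ.1.map_inv, χ.2.1.map_inv]
      · have h0 : ∀ τ : traces Γ, 0 ≤ realQuadraticForm g x τ := fun τ =>
          (isPositiveDefinite_iff_realQuadraticForm.1 τ.2.1).2 n g x
        have h1 := setIntegral_le_integral (s := {χ}) (hint (realQuadraticForm g x)) (.of_forall h0)
        rw [hrep, integral_singleton] at h1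
        rw [map_sub, map_smul]
        exact sub_nonneg.2 h1
  · -- The countable set `S` is null, so almost every trace in the decomposition vanishes at `g`.
    push Not at h
    right
    have hnull : ∀ᵐ τ : traces Γ ∂μ, (τ : Γ → ℂ) ∉ S := by
      have hc : (Subtype.val ⁻¹' S : Set (traces Γ)).Countable :=
        hS.preimage Subtype.val_injective
      rw [ae_iff]
      simp only [not_not]
      have := (measure_biUnion_null_iff (μ := μ) (s := fun τ => {τ}) hc).2 fun τ hτ => h τ hτ
      rwa [Set.biUnion_of_singleton] at this
    have hz : ∀ᵐ τ : traces Γ ∂μ, (τ : Γ → ℂ) g = 0 := by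
      filter_upwards [hae, hnull] with τ h1 h2 using hg _ h1 h2
    let p : (Γ → ℂ) →L[ℝ] ℂ := ContinuousLinearMap.proj (R := ℝ) (φ := fun _ : Γ => ℂ) g
    refine Complex.ext ?_ ?_
    · have := hrep (Complex.reCLM ∘L p)
      rw [integral_congr_ae (g := 0) (hz.mono fun τ hτ => by simp [p, hτ])] at this
      simpa [p] using this.symm
    · have := hrep (Complex.imCLM ∘L p)
      rw [integral_congr_ae (g := 0) (hz.mono fun τ hτ => by simp [p, hτ])] at this
      simpa [p] using this.symm

/-- The normalized trace depends only on the unitary equivalence class. -/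
theorem countable_setOf_isFiniteDimensional (h : CountablyManyFinDimUnitaryReps Γ) :
    {φ : Γ → ℂ | IsFiniteDimensional φ}.Countable := by
  have : Countable (Σ n : ℕ, Quotient (unitaryEquivalence Γ n)) := h
  let F : (Σ n : ℕ, Quotient (unitaryEquivalence Γ n)) → Γ → ℂ := fun q =>
    Quotient.lift (s := unitaryEquivalence Γ q.1)
      (fun π g => (1 / (q.1 : ℂ)) * (π g : Matrix (Fin q.1) (Fin q.1) ℂ).trace) (by
        rintro π ρ ⟨u, hu⟩
        ext g
        have : (u : Matrix (Fin q.1) (Fin q.1) ℂ) *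
            ((π g : Matrix (Fin q.1) (Fin q.1) ℂ) * star (u : Matrix (Fin q.1) (Fin q.1) ℂ)) =
              ρ g := by
          rw [hu g]; simp [mul_assoc]
        rw [← this, trace_mul_comm, mul_assoc]
        simp) q.2
  refine (Set.countable_range F).mono ?_
  rintro φ ⟨n, π, -, h⟩
  exact ⟨⟨n, Quotient.mk _ π⟩, (funext h).symm⟩

end Decomposition

/-! ### Finite-dimensional invariant subspaces from domination -/

section Translations

open Matrix
open scoped ComplexOrder ComplexConjugate InnerProductSpace

variable {X : Type*} {H F : Type*} [NormedAddCommGroup H] [InnerProductSpace ℂ H]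
  [NormedAddCommGroup F] [InnerProductSpace ℂ F] [CompleteSpace F]

theorem eq_of_forall_inner_eq {v : X → H}
    (hd : (Submodule.span ℂ (Set.range v)).topologicalClosure = ⊤) {x y : H}
    (h : ∀ i, ⟪x, v i⟫_ℂ = ⟪y, v i⟫_ℂ) : x = y :=
  ext_inner_right ℂ fun z => DFunLike.congr_fun
    (clm_eq_of_eqOn (S := innerSL ℂ x) (T := innerSL ℂ y) hd (by simpa using h)) z

theorem exists_isometry_of_gram_eq [CompleteSpace H] {v : X → H} {w : X → F}
    (hd : (Submodule.span ℂ (Set.range v)).topologicalClosure = ⊤)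
    (h : ∀ x y, ⟪w x, w y⟫_ℂ = ⟪v x, v y⟫_ℂ) :
    ∃ T : H →L[ℂ] F, (∀ x, T (v x) = w x) ∧ ∀ x y, ⟪T x, T y⟫_ℂ = ⟪x, y⟫_ℂ := by
  have hg : gram ℂ w = gram ℂ v := by ext x y; simp [gram_apply, h]
  obtain ⟨T, hT⟩ := exists_clm_of_posSemidef (v := v) (w := w) (C := 1) hd
    (by rw [hg, one_smul, sub_self]; exact .zero)
  refine ⟨T, hT, fun x y => ?_⟩
  have h1 : (ContinuousLinearMap.adjoint T) ∘L T = ContinuousLinearMap.id ℂ H :=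
    clm_eq_of_eqOn hd fun i => eq_of_forall_inner_eq hd fun j => by
      simp [ContinuousLinearMap.adjoint_inner_left, hT, h]
  rw [← ContinuousLinearMap.adjoint_inner_left, ← ContinuousLinearMap.comp_apply, h1]
  simp

variable {Λ : Type*} [Group Λ]

/-- The left regular action on the GNS space. -/
theorem exists_translation [CompleteSpace H] {φ : Λ → ℂ} {v : Λ → H}
    (hd : (Submodule.span ℂ (Set.range v)).topologicalClosure = ⊤)
    (hv : ∀ x y, ⟪v x, v y⟫_ℂ = φ (x⁻¹ * y)) :
    ∃ U : Λ →* (H →L[ℂ] H), (∀ g x, U g (v x) = v (g * x)) ∧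
      ∀ g x y, ⟪U g x, U g y⟫_ℂ = ⟪x, y⟫_ℂ := by
  choose U hU hUi using fun g : Λ => exists_isometry_of_gram_eq (w := fun x => v (g * x)) hd
    fun x y => by rw [hv, hv]; group
  refine ⟨⟨⟨U, ?_⟩, fun g h => ?_⟩, hU, hUi⟩
  · exact clm_eq_of_eqOn hd fun x => by simp [hU]
  · exact clm_eq_of_eqOn hd fun x => by simp [hU, mul_assoc]

end Translations

section CompactIntertwiner

open Matrix
open scoped ComplexOrder ComplexConjugate InnerProductSpace

variable {Λ : Type*} [Group Λ] {H : Type*} [NormedAddCommGroup H] [InnerProductSpace ℂ H]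
  [CompleteSpace H]

theorem isCompactOperator_rankOne {H : Type*} [NormedAddCommGroup H] [InnerProductSpace ℂ H]
    (x y : H) :
    IsCompactOperator (InnerProductSpace.rankOne ℂ x y) := by
  rw [InnerProductSpace.rankOne_def']
  exact IsCompactOperator.clm_comp (isCompactOperator_of_locallyCompactSpace_dom
    (innerSL ℂ y)) (ContinuousLinearMap.toSpanSingleton ℂ x)

/-- A bounded family of operators that is compact on a total family is compact throughout. -/
theorem isCompactOperator_of_forall {X K : Type*} [NormedAddCommGroup K]
    [InnerProductSpace ℂ K] {w : X → K}
    (hd : (Submodule.span ℂ (Set.range w)).topologicalClosure = ⊤)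
    (A : K →L[ℂ] H →L[ℂ] H) (h : ∀ x, IsCompactOperator (A (w x))) (t : K) :
    IsCompactOperator (A t) := by
  let P : Submodule ℂ K := (compactOperator (RingHom.id ℂ) H H).comap A.toLinearMap
  have hP : IsClosed (P : Set K) :=
    (isClosed_setOfPred_isCompactOperator (σ₁₂ := RingHom.id ℂ) (M₁ := H) (M₂ := H)).preimage
      A.continuous
  have : (⊤ : Submodule ℂ K) ≤ P := by
    rw [← hd]
    refine Submodule.topologicalClosure_minimal _ (Submodule.span_le.2 ?_) hP
    rintro _ ⟨x, rfl⟩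
    exact h x
  exact this trivial

/-- A nonzero compact self-adjoint operator commuting with `U` has a nonzero eigenvalue, whose
eigenspace is finite-dimensional and invariant. -/
theorem exists_eigenspace_of_compact {U : Λ →* (H →L[ℂ] H)} {D : H →L[ℂ] H}
    (hD : IsCompactOperator D) (hs : (D : H →ₗ[ℂ] H).IsSymmetric) (h0 : D ≠ 0)
    (hU : ∀ g x, D (U g x) = U g (D x)) :
    ∃ W : Submodule ℂ H, FiniteDimensional ℂ W ∧ W ≠ ⊥ ∧ ∀ g, ∀ x ∈ W, U g x ∈ W := by
  have h1 := mt (ContinuousLinearMap.eq_zero_of_forall_hasEigenvalue_eq_zero hD hs).1 h0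
  push Not at h1
  obtain ⟨c, hc, hc0⟩ := h1
  refine ⟨_, ContinuousLinearMap.finite_dimensional_eigenspace hD c hc0, hc, fun g x hx => ?_⟩
  rw [Module.End.mem_eigenspace_iff] at hx ⊢
  change D x = c • x at hx
  change D (U g x) = c • U g x
  rw [hU, hx, map_smul]

theorem trace_inv_mul_eq {d : ℕ} (σ : UnitaryRep Λ d) (g h : Λ) :
    (σ (g⁻¹ * h) : Matrix (Fin d) (Fin d) ℂ).trace =
      ∑ p : Fin d × Fin d, (σ h : Matrix (Fin d) (Fin d) ℂ) p.1 p.2 *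
        conj ((σ g : Matrix (Fin d) (Fin d) ℂ) p.1 p.2) := by
  rw [map_mul, map_inv, Fintype.sum_prod_type_right]
  simp only [trace, diag_apply, UnitaryGroup.mul_apply, UnitaryGroup.inv_apply, mul_apply]
  refine Finset.sum_congr rfl fun i _ => Finset.sum_congr rfl fun j _ => ?_
  simp [star_apply, mul_comm]

/-- If `|φ|²` dominates a positive multiple of the trace of a finite-dimensional representation `σ`,
then the GNS space of `φ` has a nonzero finite-dimensional invariant subspace. -/
theorem exists_invariant_of_dominated {φ : Λ → ℂ} {v : Λ → H}
    (hv : ∀ x y, ⟪v x, v y⟫_ℂ = φ (x⁻¹ * y)) (hφ : IsPositiveDefinite φ)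
    {U : Λ →* (H →L[ℂ] H)} (hUv : ∀ g x, U g (v x) = v (g * x))
    (hUi : ∀ g x y, ⟪U g x, U g y⟫_ℂ = ⟪x, y⟫_ℂ)
    {d : ℕ} (i₀ : Fin d) (σ : UnitaryRep Λ d) {a : ℝ} (ha : 0 < a)
    (hdom : IsPositiveDefinite (φ * star φ -
      a • fun g => (σ g : Matrix (Fin d) (Fin d) ℂ).trace)) :
    ∃ W : Submodule ℂ H, FiniteDimensional ℂ W ∧ W ≠ ⊥ ∧ ∀ g, ∀ x ∈ W, U g x ∈ W := by
  have hUU : ∀ g x, U g (U g⁻¹ x) = x := fun g x => by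
    rw [← mul_apply_eq_comp, ← map_mul]; simp
  have hUU' : ∀ g x, U g⁻¹ (U g x) = x := fun g x => by simpa using hUU g⁻¹ x
  obtain ⟨K, _, _, _, w, hw, hwd⟩ := exists_hilbert_of_posSemidef
    (isPositiveDefinite_iff.1 (hφ.mul hφ.star))
  obtain ⟨V, hVw, hVi⟩ := exists_translation (φ := φ * star φ) hwd hw
  have hVV : ∀ g x, V g (V g⁻¹ x) = x := fun g x => by
    rw [← mul_apply_eq_comp, ← map_mul]; simp
  have hwv : ∀ x y, ⟪w x, w y⟫_ℂ = ⟪v x, v y⟫_ℂ * ⟪v y, v x⟫_ℂ := fun x y => by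
    rw [hw, hv, hv, kernelMatrix_apply, Pi.mul_apply, Pi.star_apply, Complex.star_def,
      ← hφ.map_inv]
    simp
  obtain ⟨A, hA⟩ := exists_clm_of_norm_le (C := 1) hwd
    (fun c => (norm_linearCombination_rankOne_le v hwv c).trans_eq (one_mul _).symm)
  -- By the domination, the matrix coefficients of `σ` are bounded on the Hilbert space of `|φ|²`;
  -- the vectors `t j` represent the coefficients in the column `i₀`.
  obtain ⟨T, hT⟩ := exists_clm_of_posSemidef (C := a⁻¹) (v := w)
    (w := fun g => WithLp.toLp 2 fun p : Fin d × Fin d =>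
      (σ g : Matrix (Fin d) (Fin d) ℂ) p.1 p.2) hwd (by
    have := (isPositiveDefinite_iff.1 (hdom.smul (inv_nonneg.2 ha.le)))
    convert this using 1
    ext x y
    simp [gram_apply, hw, PiLp.inner_apply, smul_sub, smul_smul, ha.ne']
    rw [← trace_inv_mul_eq]
    simp)
  let t : Fin d → K := fun j =>
    (InnerProductSpace.toDual ℂ K).symm (EuclideanSpace.proj (j, i₀) ∘L T)
  have ht : ∀ j g, ⟪t j, w g⟫_ℂ = (σ g : Matrix (Fin d) (Fin d) ℂ) j i₀ := fun j g => by
    simp [t, InnerProductSpace.toDual_symm_apply, hT]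
  have hVt : ∀ h j, V h (t j) = ∑ k, (σ h : Matrix (Fin d) (Fin d) ℂ) k j • t k := fun h j => by
    refine eq_of_forall_inner_eq hwd fun g => ?_
    have e : w g = V h (w (h⁻¹ * g)) := by rw [hVw]; simp
    rw [e, hVi, ← e, ht, map_mul, map_inv, UnitaryGroup.mul_apply, mul_apply, sum_inner]
    refine Finset.sum_congr rfl fun k _ => ?_
    rw [inner_smul_left, ht, UnitaryGroup.inv_apply, star_apply]
    rfl
  have hAV : ∀ h s x, A (V h s) x = U h (A s (U h⁻¹ x)) := fun h s x => by
    have : (ContinuousLinearMap.apply ℂ H x) ∘L A ∘L V h =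
        U h ∘L (ContinuousLinearMap.apply ℂ H (U h⁻¹ x)) ∘L A := by
      refine clm_eq_of_eqOn hwd fun g => ?_
      have e : ⟪v g, U h⁻¹ x⟫_ℂ = ⟪v (h * g), x⟫_ℂ := by rw [← hUi h, hUU, hUv]
      simp [hVw, hA, InnerProductSpace.rankOne_apply, hUv, e]
    exact DFunLike.congr_fun this s
  -- Unitarity of `σ` makes the positive compact operator `D` commute with `U`.
  let D : H →L[ℂ] H := ∑ j, ContinuousLinearMap.adjoint (A (t j)) ∘L A (t j)
  have hDi : ∀ x y, ⟪D x, y⟫_ℂ = ∑ j, ⟪A (t j) x, A (t j) y⟫_ℂ := fun x y => by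
    simp [D, _root_.sum_apply, ContinuousLinearMap.adjoint_inner_left]
  have hDU : ∀ h x y, ⟪D (U h x), U h y⟫_ℂ = ⟪D x, y⟫_ℂ := fun h x y => by
    have e : ∀ j x, A (t j) (U h x) =
        U h (∑ k, (σ h⁻¹ : Matrix (Fin d) (Fin d) ℂ) k j • A (t k) x) := fun j x => by
      have := hAV h (V h⁻¹ (t j)) (U h x)
      rw [hVV, hUU', hVt h⁻¹ j] at this
      simpa [_root_.sum_apply] using this
    have hu : ∀ k l, ∑ j, (σ h⁻¹ : Matrix (Fin d) (Fin d) ℂ) l j *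
        conj ((σ h⁻¹ : Matrix (Fin d) (Fin d) ℂ) k j) = (1 : Matrix (Fin d) (Fin d) ℂ) l k :=
      fun k l => by
        rw [← mem_unitaryGroup_iff.1 (σ h⁻¹).2, mul_apply]
        rfl
    have e2 : ∀ j, ⟪A (t j) (U h x), A (t j) (U h y)⟫_ℂ = ∑ k, ∑ l,
        (σ h⁻¹ : Matrix (Fin d) (Fin d) ℂ) l j * conj ((σ h⁻¹ : Matrix (Fin d) (Fin d) ℂ) k j) *
          ⟪A (t k) x, A (t l) y⟫_ℂ := fun j => by
      rw [e, e, hUi, sum_inner]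
      refine Finset.sum_congr rfl fun k _ => ?_
      rw [inner_sum]
      refine Finset.sum_congr rfl fun l _ => ?_
      rw [inner_smul_left, inner_smul_right]
      ring
    rw [hDi, hDi, Finset.sum_congr rfl fun j _ => e2 j, Finset.sum_comm]
    refine Finset.sum_congr rfl fun k _ => ?_
    rw [Finset.sum_comm]
    simp only [← Finset.sum_mul, hu, one_apply, ite_mul, one_mul, zero_mul, Finset.sum_ite_eq',
      Finset.mem_univ, if_true]
  refine exists_eigenspace_of_compact (U := U) (D := D) ?_ ?_ ?_ ?_
  · have : D ∈ compactOperator (RingHom.id ℂ) H H := Submodule.sum_mem _ fun j _ => by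
      have h1 := isCompactOperator_of_forall hwd A (fun x => by
        rw [hA]; exact isCompactOperator_rankOne _ _) (t j)
      exact h1.clm_comp (ContinuousLinearMap.adjoint (A (t j)))
    exact this
  · intro x y
    change ⟪D x, y⟫_ℂ = ⟪x, D y⟫_ℂ
    rw [← inner_conj_symm x, hDi, hDi, map_sum]
    simp
  · -- `D = 0` forces `A (t i₀) (v 1) = 0`, whereas `⟪v 1, A (t i₀) (v 1)⟫ = conj (σ 1 i₀ i₀) = 1`.
    intro h0
    have h1 : ∀ s g, ⟪v g, A s (v g)⟫_ℂ = ⟪w g, s⟫_ℂ := fun s g => by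
      have : (innerSL ℂ (v g)) ∘L (ContinuousLinearMap.apply ℂ H (v g)) ∘L A = innerSL ℂ (w g) := by
        refine clm_eq_of_eqOn hwd fun k => ?_
        simp [hA, InnerProductSpace.rankOne_apply, hwv, mul_comm]
      exact DFunLike.congr_fun this s
    have h2 := hDi (v 1) (v 1)
    simp only [h0, _root_.zero_apply, inner_zero_left, inner_self_eq_norm_sq_to_K] at h2
    have h3 : ∑ j, ‖A (t j) (v 1)‖ ^ 2 = 0 := by
      apply Complex.ofReal_injective
      push_cast
      exact h2.symm
    have h4 := (Finset.sum_eq_zero_iff_of_nonneg fun j _ => sq_nonneg _).1 h3 i₀ (Finset.mem_univ _)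
    have h5 := h1 (t i₀) 1
    rw [norm_eq_zero.1 (pow_eq_zero_iff two_ne_zero |>.1 h4), inner_zero_right,
      ← inner_conj_symm, ht] at h5
    simp at h5
  · intro g x
    refine ext_inner_right ℂ fun y => ?_
    have := hDU g x (U g⁻¹ y)
    rw [hUU] at this
    rw [this, ← hUi g, hUU]

end CompactIntertwiner

/-! ### Characters with a finite-dimensional invariant subspace -/

section FiniteDimensionalSubrep

open Matrix Module
open scoped ComplexOrder ComplexConjugate InnerProductSpace

variable {Λ : Type*} [Group Λ] {H : Type*} [NormedAddCommGroup H] [InnerProductSpace ℂ H]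

theorem starProjection_translation {U : Λ →* (H →L[ℂ] H)}
    (hUi : ∀ g x y, ⟪U g x, U g y⟫_ℂ = ⟪x, y⟫_ℂ) {W : Submodule ℂ H} [W.HasOrthogonalProjection]
    (hW : ∀ g, ∀ x ∈ W, U g x ∈ W) (g : Λ) (x : H) :
    W.starProjection (U g x) = U g (W.starProjection x) := by
  refine (Submodule.eq_starProjection_of_mem_of_inner_eq_zero
    (hW g _ (Submodule.starProjection_apply_mem W x)) fun y hy => ?_)
  have e : y = U g (U g⁻¹ y) := by rw [← mul_apply_eq_comp, ← map_mul]; simp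
  rw [e, ← map_sub, hUi]
  exact Submodule.starProjection_inner_eq_zero x _ (hW g⁻¹ y hy)

/-- For `w` in a finite-dimensional invariant subspace `W`, the orbit map `v g ↦ U g w` is bounded.
For `w` in the span of the `v h` this is a combination of right translations, and `W` is the
projection of that span. -/
theorem exists_clm_orbit [CompleteSpace H] {φ : Λ → ℂ}
    (hc : ∀ g h : Λ, φ (h * g * h⁻¹) = φ g) {v : Λ → H}
    (hd : (Submodule.span ℂ (Set.range v)).topologicalClosure = ⊤)
    (hv : ∀ x y, ⟪v x, v y⟫_ℂ = φ (x⁻¹ * y))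
    {U : Λ →* (H →L[ℂ] H)} (hUv : ∀ g x, U g (v x) = v (g * x))
    (hUi : ∀ g x y, ⟪U g x, U g y⟫_ℂ = ⟪x, y⟫_ℂ)
    {W : Submodule ℂ H} [FiniteDimensional ℂ W] (hW : ∀ g, ∀ x ∈ W, U g x ∈ W)
    {w : H} (hw : w ∈ W) : ∃ S : H →L[ℂ] H, ∀ g, S (v g) = U g w := by
  have hspan : ∀ x ∈ Submodule.span ℂ (Set.range v), ∃ S : H →L[ℂ] H, ∀ g, S (v g) = U g x := by
    intro x hx
    induction hx using Submodule.span_induction with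
    | mem x hx =>
      obtain ⟨h, rfl⟩ := hx
      -- Conjugation invariance of `φ` makes right translation by `h` isometric.
      obtain ⟨R, hR, -⟩ := exists_isometry_of_gram_eq (w := fun x => v (x * h)) hd fun x y => by
        rw [hv, hv, ← hc (x⁻¹ * y) h⁻¹]
        group
      exact ⟨R, fun g => by rw [hR, hUv]⟩
    | zero => exact ⟨0, by simp⟩
    | add x y _ _ hx hy =>
      obtain ⟨S, hS⟩ := hx
      obtain ⟨T, hT⟩ := hy
      exact ⟨S + T, fun g => by simp [hS, hT]⟩
    | smul c x _ hx =>
      obtain ⟨S, hS⟩ := hx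
      exact ⟨c • S, fun g => by simp [hS]⟩
  -- the projection of the dense subspace `span (range v)` to `W` is all of `W`
  let N : Submodule ℂ H := (Submodule.span ℂ (Set.range v)).map W.starProjection.toLinearMap
  have hNW : N ≤ W := by
    rintro _ ⟨x, -, rfl⟩
    exact Submodule.starProjection_apply_mem W x
  have : FiniteDimensional ℂ N := Submodule.finiteDimensional_of_le hNW
  have hN : IsClosed ((N.comap W.starProjection.toLinearMap : Submodule ℂ H) : Set H) :=
    N.closed_of_finiteDimensional.preimage W.starProjection.continuous
  have htop : (⊤ : Submodule ℂ H) ≤ N.comap W.starProjection.toLinearMap := by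
    rw [← hd]
    exact Submodule.topologicalClosure_minimal _ (Submodule.le_comap_map _ _) hN
  obtain ⟨x, hx, hxw⟩ : W.starProjection w ∈ N := htop (Submodule.mem_top (x := w))
  obtain ⟨S, hS⟩ := hspan x hx
  refine ⟨W.starProjection ∘L S, fun g => ?_⟩
  rw [ContinuousLinearMap.comp_apply, hS, starProjection_translation hUi hW]
  congr 1
  exact hxw.trans (Submodule.starProjection_eq_self_iff.2 hw)

theorem exists_minimal_invariant {U : Λ →* (H →L[ℂ] H)}
    (h : ∃ W : Submodule ℂ H, FiniteDimensional ℂ W ∧ W ≠ ⊥ ∧ ∀ g, ∀ x ∈ W, U g x ∈ W) :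
    ∃ W : Submodule ℂ H, FiniteDimensional ℂ W ∧ W ≠ ⊥ ∧ (∀ g, ∀ x ∈ W, U g x ∈ W) ∧
      ∀ W' : Submodule ℂ H, W' ≤ W → W' ≠ ⊥ → (∀ g, ∀ x ∈ W', U g x ∈ W') → W' = W := by
  let P : Set (Submodule ℂ H) :=
    {W | FiniteDimensional ℂ W ∧ W ≠ ⊥ ∧ ∀ g, ∀ x ∈ W, U g x ∈ W}
  obtain ⟨W, ⟨h1, h2, h3⟩, hmin⟩ :=
    (measure fun W : Submodule ℂ H => finrank ℂ W).wf.has_min P h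
  refine ⟨W, h1, h2, h3, fun W' hle hne hinv => ?_⟩
  have hfd : FiniteDimensional ℂ W' := Submodule.finiteDimensional_of_le hle
  exact Submodule.eq_of_le_of_finrank_le hle (not_lt.1 (hmin W' ⟨hfd, hne, hinv⟩))

/-- The matrices of a unitary action on an invariant subspace in an orthonormal basis. -/
theorem exists_unitaryRep_inner {U : Λ →* (H →L[ℂ] H)}
    (hUi : ∀ g x y, ⟪U g x, U g y⟫_ℂ = ⟪x, y⟫_ℂ) {W : Submodule ℂ H}
    (hW : ∀ g, ∀ x ∈ W, U g x ∈ W) {n : ℕ} (e : OrthonormalBasis (Fin n) ℂ W) :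
    ∃ π : UnitaryRep Λ n, ∀ g i j,
      (π g : Matrix (Fin n) (Fin n) ℂ) i j = ⟪(e i : H), U g (e j)⟫_ℂ := by
  let M : Λ → Matrix (Fin n) (Fin n) ℂ := fun g => .of fun i j => ⟪(e i : H), U g (e j)⟫_ℂ
  have hM : ∀ g i j, M g i j = ⟪(e i : H), U g (e j)⟫_ℂ := fun _ _ _ => rfl
  have hM1 : M 1 = 1 := by
    ext i j
    have := orthonormal_iff_ite.1 e.orthonormal i j
    rw [hM, map_one, one_apply_eq_self, one_apply]
    simpa using this
  have hMmul : ∀ g h, M (g * h) = M g * M h := fun g h => by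
    ext i j
    have := congrArg Subtype.val (e.sum_repr' ⟨U h (e j), hW h _ (e j).2⟩)
    have hUe : U h (e j) = ∑ k, M h k j • (e k : H) := by simpa [hM] using this.symm
    rw [hM, map_mul, mul_apply_eq_comp, hUe, map_sum, inner_sum, mul_apply]
    refine Finset.sum_congr rfl fun k _ => ?_
    rw [map_smul, inner_smul_right, hM g, mul_comm]
  have hMstar : ∀ g, star (M g) = M g⁻¹ := fun g => by
    ext i j
    rw [star_apply, hM, hM, Complex.star_def, inner_conj_symm, ← hUi g (e i) (U g⁻¹ (e j)),
      ← mul_apply_eq_comp (U g), ← map_mul]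
    simp
  exact ⟨{ toFun := fun g => ⟨M g, mem_unitaryGroup_iff.2 (by rw [hMstar, ← hMmul]; simp [hM1])⟩
           map_one' := Subtype.ext hM1
           map_mul' := fun g h => Subtype.ext (hMmul g h) }, hM⟩

theorem isIrreducible_of_minimal {U : Λ →* (H →L[ℂ] H)} {W : Submodule ℂ H} (hne : W ≠ ⊥)
    (hW : ∀ g, ∀ x ∈ W, U g x ∈ W)
    (hmin : ∀ W' : Submodule ℂ H, W' ≤ W → W' ≠ ⊥ → (∀ g, ∀ x ∈ W', U g x ∈ W') → W' = W)
    {n : ℕ} (e : OrthonormalBasis (Fin n) ℂ W) {π : UnitaryRep Λ n}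
    (hπ : ∀ g i j, (π g : Matrix (Fin n) (Fin n) ℂ) i j = ⟪(e i : H), U g (e j)⟫_ℂ) :
    π.toRepresentation.IsIrreducible := by
  let ι : (Fin n → ℂ) →ₗ[ℂ] H := W.subtype ∘ₗ e.toBasis.equivFun.symm.toLinearMap
  have hι : ∀ x, ι x = ∑ i, x i • (e i : H) := fun x => by
    change ((e.toBasis.equivFun.symm x : W) : H) = _
    rw [Basis.equivFun_symm_apply]
    simp
  have hinj : Function.Injective ι :=
    W.injective_subtype.comp e.toBasis.equivFun.symm.injective
  have hrange : LinearMap.range ι = W := by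
    simp [ι, LinearMap.range_comp]
  have hιU : ∀ g x, U g (ι x) = ι ((π g : Matrix (Fin n) (Fin n) ℂ) *ᵥ x) := fun g x => by
    have hUe : ∀ j, U g (e j) = ∑ i, (π g : Matrix (Fin n) (Fin n) ℂ) i j • (e i : H) :=
      fun j => by
      have := congrArg Subtype.val (e.sum_repr' ⟨U g (e j), hW g _ (e j).2⟩)
      simpa [hπ] using this.symm
    rw [hι, hι, map_sum]
    simp only [map_smul, hUe, Finset.smul_sum, mulVec, dotProduct, Finset.sum_smul, smul_smul]
    rw [Finset.sum_comm]
    simp only [mul_comm]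
  have hnt : Nontrivial (Subrepresentation π.toRepresentation) := by
    refine ⟨⊥, ⊤, fun h => hne ?_⟩
    have h1 : (⊥ : Submodule ℂ (Fin n → ℂ)) = ⊤ := congrArg Subrepresentation.toSubmodule h
    rw [← hrange, LinearMap.range_eq_map, ← h1, Submodule.map_bot]
  refine { hnt with eq_bot_or_eq_top := fun S => ?_ }
  by_cases hS : S.toSubmodule.map ι = ⊥
  · exact .inl (Subrepresentation.toSubmodule_injective
      (Submodule.map_injective_of_injective hinj (hS.trans (Submodule.map_bot ι).symm)))
  · refine .inr (Subrepresentation.toSubmodule_injective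
      (Submodule.map_injective_of_injective hinj ((hmin _ ?_ hS ?_).trans ?_)))
    · rw [← hrange]
      exact LinearMap.map_le_range
    · rintro g _ ⟨x, hx, rfl⟩
      rw [hιU]
      exact ⟨_, S.apply_mem_toSubmodule g hx, rfl⟩
    · rw [← hrange, LinearMap.range_eq_map]
      rfl

theorem IsPositiveDefinite.sum {ι : Type*} {s : Finset ι} {F : ι → Λ → ℂ}
    (hF : ∀ i ∈ s, IsPositiveDefinite (F i)) : IsPositiveDefinite (∑ i ∈ s, F i) := fun k g => by
  have := posSemidef_sum s fun i hi => hF i hi k g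
  convert this using 1
  ext i j
  simp [Matrix.sum_apply]

/-- A character whose GNS space has a nonzero finite-dimensional invariant subspace is
finite-dimensional. -/
theorem isFiniteDimensional_of_invariant [CompleteSpace H] {φ : Λ → ℂ} (hφ : φ ∈ characters Λ)
    {v : Λ → H} (hd : (Submodule.span ℂ (Set.range v)).topologicalClosure = ⊤)
    (hv : ∀ x y, ⟪v x, v y⟫_ℂ = φ (x⁻¹ * y))
    {U : Λ →* (H →L[ℂ] H)} (hUv : ∀ g x, U g (v x) = v (g * x))
    (hUi : ∀ g x y, ⟪U g x, U g y⟫_ℂ = ⟪x, y⟫_ℂ)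
    (h : ∃ W : Submodule ℂ H, FiniteDimensional ℂ W ∧ W ≠ ⊥ ∧ ∀ g, ∀ x ∈ W, U g x ∈ W) :
    IsFiniteDimensional φ := by
  obtain ⟨W, hfd, hne, hW, hmin⟩ := exists_minimal_invariant h
  have hn0 : finrank ℂ W ≠ 0 := fun h0 => hne (Submodule.finrank_eq_zero.1 h0)
  have e := stdOrthonormalBasis ℂ W
  generalize finrank ℂ W = n at e hn0
  obtain ⟨π, hπ⟩ := exists_unitaryRep_inner hUi hW e
  refine ⟨n, π, isIrreducible_of_minimal hne hW hmin e hπ, ?_⟩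
  choose S hS using fun i => exists_clm_orbit hφ.1.2.2 hd hv hUv hUi hW (e i).2
  let c : Fin n → Λ → ℂ := fun i g => ⟪(e i : H), U g (e i)⟫_ℂ
  have hg : ∀ i, kernelMatrix (c i) = gram ℂ (S i ∘ v) := fun i => by
    ext x y
    simp only [c, kernelMatrix_apply, gram_apply, Function.comp_apply, hS]
    rw [← hUi x (e i), ← mul_apply_eq_comp (U x), ← map_mul]
    simp
  have hp : ∀ i, IsPositiveDefinite (c i) := fun i => by
    rw [isPositiveDefinite_iff, hg]
    exact posSemidef_gram_family _
  have hk : ∀ i, IsPositiveDefinite (‖S i‖ ^ 2 • φ - c i) := fun i => by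
    have h1 := posSemidef_opNorm_smul_gram_sub_gram v (S i)
    have h2 : gram ℂ v = kernelMatrix φ := by ext x y; simp [gram_apply, hv]
    rw [← hg, h2] at h1
    exact isPositiveDefinite_iff.2 h1
  have ht : (fun g => (π g : Matrix (Fin n) (Fin n) ℂ).trace) = ∑ i, c i := by
    ext g
    simp [trace, hπ, c]
  have key := eq_smul_of_dominated hφ (K := ∑ i, ‖S i‖ ^ 2)
    (ht ▸ IsPositiveDefinite.sum fun i _ => hp i)
    (fun g h => by
      rw [map_mul, UnitaryGroup.mul_val, trace_mul_comm, ← UnitaryGroup.mul_val, ← map_mul]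
      group)
    (by
      have := IsPositiveDefinite.sum (s := Finset.univ) fun i _ => hk i
      rwa [Finset.sum_sub_distrib, ← Finset.sum_smul, ← ht] at this)
  intro g
  have := congrFun key g
  simp only [map_one, UnitaryGroup.one_val, trace_one, Fintype.card_fin, Pi.smul_apply,
    smul_eq_mul] at this
  have hn : (n : ℂ) ≠ 0 := by exact_mod_cast hn0
  rw [this]
  field_simp

end FiniteDimensionalSubrep

/-! ### Passing to and from the central quotient -/

section Quotient

open Matrix
open scoped ComplexOrder ComplexConjugate InnerProductSpace

variable {Λ : Type*} [Group Λ]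

theorem isFiniteDimensional_of_dominated {φ : Λ → ℂ} (hφ : φ ∈ characters Λ) {d : ℕ} (i₀ : Fin d)
    (σ : UnitaryRep Λ d) {a : ℝ} (ha : 0 < a)
    (hdom : IsPositiveDefinite (φ * star φ -
      a • fun g => (σ g : Matrix (Fin d) (Fin d) ℂ).trace)) : IsFiniteDimensional φ := by
  obtain ⟨H, _, _, _, v, hv, hd⟩ := exists_hilbert_of_posSemidef (isPositiveDefinite_iff.1 hφ.1.1)
  obtain ⟨U, hUv, hUi⟩ := exists_translation (φ := φ) hd hv
  exact isFiniteDimensional_of_invariant hφ hd hv hUv hUi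
    (exists_invariant_of_dominated hv hφ.1.1 hUv hUi i₀ σ ha hdom)

local notation "q" => QuotientGroup.mk' (Subgroup.center Λ)

/-- A trace invariant under translation by the center descends to the central quotient. -/
theorem exists_trace_comp_eq {φ : Λ → ℂ} (hφ : φ ∈ traces Λ)
    (hc : ∀ c ∈ Subgroup.center Λ, ∀ g, φ (g * c) = φ g) :
    ∃ ψ ∈ traces (Λ ⧸ Subgroup.center Λ), ψ ∘ q = φ := by
  let ψ : Λ ⧸ Subgroup.center Λ → ℂ := fun x => φ x.out
  have hψ : ∀ g, ψ (q g) = φ g := fun g => by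
    obtain ⟨c, hc'⟩ := QuotientGroup.mk_out_eq_mul (Subgroup.center Λ) g
    exact (congrArg φ hc').trans (hc c c.2 g)
  refine ⟨ψ, ⟨fun n g => ?_, ?_, fun g h => ?_⟩, funext hψ⟩
  · have h1 := hφ.1 n fun i => (g i).out
    convert h1 using 1
    ext i j
    have : (g i)⁻¹ * g j = q ((g i).out⁻¹ * (g j).out) := by
      rw [map_mul, map_inv]
      simp
    rw [of_apply, of_apply, this, hψ]
  · rw [← map_one q, hψ, hφ.2.1]
  · obtain ⟨g, rfl⟩ := QuotientGroup.mk'_surjective _ g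
    obtain ⟨h, rfl⟩ := QuotientGroup.mk'_surjective _ h
    rw [← map_inv, ← map_mul, ← map_mul, hψ, hψ, hφ.2.2]

theorem mul_star_mem_traces {φ : Λ → ℂ} (hφ : φ ∈ traces Λ) : φ * star φ ∈ traces Λ :=
  ⟨hφ.1.mul hφ.1.star, by simp [hφ.2.1], fun g h => by simp [hφ.2.2]⟩

/-- The squared modulus of a character descends to a trace on the central quotient. -/
theorem exists_trace_comp_eq_mul_star {φ : Λ → ℂ} (hφ : φ ∈ characters Λ) :
    ∃ ψ ∈ traces (Λ ⧸ Subgroup.center Λ), ψ ∘ q = φ * star φ := by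
  refine exists_trace_comp_eq (mul_star_mem_traces hφ.1) fun c hc g => ?_
  simp only [Pi.mul_apply, Pi.star_apply, Complex.star_def, Complex.mul_conj]
  rw [map_mul_of_mem_center hφ hc, Complex.normSq_mul, Complex.normSq_eq_norm_sq (φ c),
    norm_eq_one_of_mem_center hφ hc]
  simp

theorem ne_zero_of_isIrreducible {d : ℕ} {σ : UnitaryRep Λ d}
    (hσ : σ.toRepresentation.IsIrreducible) : d ≠ 0 := by
  rintro rfl
  obtain ⟨S, T, hST⟩ := hσ.toNontrivial
  exact hST (Subrepresentation.toSubmodule_injective (Subsingleton.elim _ _))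

theorem isCharacterRigid_of_quotient [Countable Λ]
    (hcenter : Subgroup.center (Λ ⧸ Subgroup.center Λ) = ⊥)
    (hreps : CountablyManyFinDimUnitaryReps (Λ ⧸ Subgroup.center Λ))
    (h : IsCharacterRigid (Λ ⧸ Subgroup.center Λ)) : IsCharacterRigid Λ := by
  intro φ hφ
  obtain ⟨ψ, hψ, hψφ⟩ := exists_trace_comp_eq_mul_star hφ
  have : Countable (Λ ⧸ Subgroup.center Λ) := (QuotientGroup.mk'_surjective _).countable
  refine or_iff_not_imp_left.2 fun hfd g hg => ?_
  have hg1 : q g ∉ Subgroup.center (Λ ⧸ Subgroup.center Λ) := by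
    rw [hcenter, Subgroup.mem_bot]
    exact fun h1 => hg ((QuotientGroup.eq_one_iff g).1 h1)
  rcases exists_dominated_or_vanishing hψ (countable_setOf_isFiniteDimensional hreps)
    (fun χ hχ hχS => ((h χ hχ).resolve_left hχS) (q g) hg1) with ⟨χ, hχ, a, ha, hdom⟩ | h0
  · obtain ⟨d, σ, hσ, hχσ⟩ := hχ
    have hd : d ≠ 0 := ne_zero_of_isIrreducible hσ
    refine absurd (isFiniteDimensional_of_dominated hφ ⟨0, Nat.pos_of_ne_zero hd⟩ (σ.comp q)
      (a := a / d) (by positivity) ?_) hfd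
    have h1 := hdom.comp q
    convert h1 using 1
    rw [← hψφ]
    ext x
    simp [hχσ]
    ring
  · have h1 : φ g * conj (φ g) = 0 := (congrFun hψφ g).symm.trans h0
    simpa using h1

theorem eq_one_of_combo_eq_one {z w : ℂ} (hz : ‖z‖ ≤ 1) (hw : ‖w‖ ≤ 1) {a b : ℝ} (ha : 0 < a)
    (hb : 0 < b) (hab : a + b = 1) (h : a • z + b • w = 1) : z = 1 := by
  have h1 := congrArg Complex.re h
  simp only [Complex.real_smul, Complex.add_re, Complex.re_ofReal_mul, Complex.one_re] at h1
  have h2 := mul_le_mul_of_nonneg_left ((Complex.re_le_norm w).trans hw) hb.le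
  have h3 : z.re = 1 := by
    refine le_antisymm ((Complex.re_le_norm z).trans hz) (le_of_mul_le_mul_left ?_ ha)
    linarith
  have h4 : ‖z‖ ^ 2 ≤ 1 := pow_le_one₀ (norm_nonneg _) hz
  rw [← Complex.normSq_eq_norm_sq, Complex.normSq_apply, h3] at h4
  have h5 : z.im = 0 := by nlinarith
  exact Complex.ext h3 h5

theorem comp_mem_characters {ψ : Λ ⧸ Subgroup.center Λ → ℂ}
    (hψ : ψ ∈ characters (Λ ⧸ Subgroup.center Λ)) : ψ ∘ q ∈ characters Λ := by
  obtain ⟨⟨h1, h2, h3⟩, hext⟩ := mem_extremePoints_iff_left.1 hψ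
  refine mem_extremePoints_iff_left.2 ⟨⟨h1.comp q, by simp [h2], fun g h => by simp [h3]⟩, ?_⟩
  rintro τ₁ hτ₁ τ₂ hτ₂ ⟨a, b, ha, hb, hab, hτ⟩
  have hcen : ∀ c ∈ Subgroup.center Λ, τ₁ c = 1 ∧ τ₂ c = 1 := fun c hc => by
    have h := congrFun hτ c
    have hq : ψ (q c) = 1 := by
      rw [show q c = 1 from (QuotientGroup.eq_one_iff c).2 hc, h2]
    simp only [Pi.add_apply, Pi.smul_apply, Function.comp_apply, hq] at h
    have n1 := norm_le_one_of_mem_traces hτ₁ c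
    have n2 := norm_le_one_of_mem_traces hτ₂ c
    exact ⟨eq_one_of_combo_eq_one n1 n2 ha hb hab h,
      eq_one_of_combo_eq_one n2 n1 hb ha ((add_comm _ _).trans hab) ((add_comm _ _).trans h)⟩
  obtain ⟨ψ₁, hψ₁, rfl⟩ := exists_trace_comp_eq hτ₁ fun c hc =>
    map_mul_of_map_eq_one hτ₁ (hcen c hc).1
  obtain ⟨ψ₂, hψ₂, rfl⟩ := exists_trace_comp_eq hτ₂ fun c hc =>
    map_mul_of_map_eq_one hτ₂ (hcen c hc).2
  rw [hext ψ₁ hψ₁ ψ₂ hψ₂ ⟨a, b, ha, hb, hab, funext fun x => ?_⟩]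
  obtain ⟨g, rfl⟩ := QuotientGroup.mk'_surjective _ x
  exact congrFun hτ g

theorem eq_one_of_trace_eq {d : ℕ} {M : Matrix (Fin d) (Fin d) ℂ} (hM : M ∈ unitaryGroup (Fin d) ℂ)
    (h : M.trace = d) : M = 1 := by
  have h1 : ((M - 1)ᴴ * (M - 1)).trace = 0 := by
    have h2 : Mᴴ * M = 1 := mem_unitaryGroup_iff'.1 hM
    rw [conjTranspose_sub, conjTranspose_one, sub_mul, mul_sub, h2, mul_one, one_mul,
      trace_sub, trace_sub, trace_sub, trace_conjTranspose, h]
    simp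
  exact sub_eq_zero.1 (trace_conjTranspose_mul_self_eq_zero_iff.1 h1)

theorem isIrreducible_of_comp {Γ : Type*} [Group Γ] (p : Λ →* Γ) {d : ℕ} {σ : UnitaryRep Γ d}
    (h : UnitaryRep.toRepresentation (σ.comp p : UnitaryRep Λ d) |>.IsIrreducible) :
    σ.toRepresentation.IsIrreducible := by
  have hnt : Nontrivial (Subrepresentation σ.toRepresentation) := by
    refine ⟨⊥, ⊤, fun hbt => ?_⟩
    have := ne_zero_of_isIrreducible h
    have : Nonempty (Fin d) := ⟨⟨0, Nat.pos_of_ne_zero this⟩⟩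
    exact bot_ne_top (α := Submodule ℂ (Fin d → ℂ))
      (congrArg Subrepresentation.toSubmodule hbt)
  refine { hnt with eq_bot_or_eq_top := fun S => ?_ }
  let S' : Subrepresentation (UnitaryRep.toRepresentation (σ.comp p : UnitaryRep Λ d)) :=
    ⟨S.toSubmodule, fun g => S.apply_mem_toSubmodule (p g)⟩
  refine (h.eq_bot_or_eq_top S').imp (fun h' => ?_) fun h' => ?_ <;>
  exact Subrepresentation.toSubmodule_injective (congrArg Subrepresentation.toSubmodule h' :)

theorem isCharacterRigid_quotient (h : IsCharacterRigid Λ) :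
    IsCharacterRigid (Λ ⧸ Subgroup.center Λ) := by
  intro ψ hψ
  refine (h _ (comp_mem_characters hψ)).imp (fun hfd => ?_) fun hvan x hx => ?_
  · obtain ⟨d, σ, hσ, hψσ⟩ := hfd
    have hd : (d : ℂ) ≠ 0 := by exact_mod_cast ne_zero_of_isIrreducible hσ
    have hker : Subgroup.center Λ ≤ σ.ker := fun c hc => by
      have h1 := hψσ c
      rw [Function.comp_apply, show q c = 1 from (QuotientGroup.eq_one_iff c).2 hc, hψ.1.2.1] at h1
      refine MonoidHom.mem_ker.2 (Subtype.ext (eq_one_of_trace_eq (σ c).2 ?_))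
      field_simp at h1
      exact h1.symm
    let σ' : UnitaryRep (Λ ⧸ Subgroup.center Λ) d := QuotientGroup.lift _ σ hker
    have hσ' : σ'.comp q = σ := MonoidHom.ext fun g => rfl
    refine ⟨d, σ', isIrreducible_of_comp q (hσ' ▸ hσ), fun x => ?_⟩
    obtain ⟨g, rfl⟩ := QuotientGroup.mk'_surjective _ x
    exact hψσ g
  · obtain ⟨g, rfl⟩ := QuotientGroup.mk'_surjective _ x
    refine hvan g fun hg => hx ?_
    rw [show q g = 1 from (QuotientGroup.eq_one_iff g).2 hg]
    exact one_mem _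

end Quotient

end CharRigidity

end

theorem mainTheorem9 {Λ : Type*} [Group Λ] [Countable Λ]
    (hcenter : Subgroup.center (Λ ⧸ Subgroup.center Λ) = ⊥)
    (hreps : CharRigidity.CountablyManyFinDimUnitaryReps (Λ ⧸ Subgroup.center Λ)) :
    CharRigidity.IsCharacterRigid Λ ↔
      CharRigidity.IsCharacterRigid (Λ ⧸ Subgroup.center Λ) :=
  ⟨CharRigidity.isCharacterRigid_quotient, CharRigidity.isCharacterRigid_of_quotient hcenter hreps⟩
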